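/- Let $n \ge 4$ and let $(M,g)$ be an $n$-dimensional spacetime, i.e. a smooth manifold with a smooth Lorentzian metric of signature $(-,+,\dots,+)$, with Levi-Civita connection $\nabla$, $\Box = g^{ab}\nabla_a\nabla_b$, and curvature convention $v_{a;bc}-v_{a;cb}=R^d{}_{abc}v_d$, $R_{ab}=R^c{}_{acb}$. Let $\kappa\neq 0$, $\Lambda_0,\alpha,\beta,\gamma,\Lambda$ be real constants, let $\Phi$ be a real function and $\boldsymbol\ell$ a nowhere vanishing null vector field on $M$ such that $$R_{ab} = \frac{2\Lambda}{n-2}\, g_{ab} + \Phi\, \ell_a \ell_b .$$ Assume that at every point the Weyl tensor $C_{abcd}$ is of type III(B) or N with $\boldsymbol\ell$ as multiple Weyl aligned null direction, or of type O. Explicitly, at every point either $C_{abcd}=0$ (type O), or $\boldsymbol\ell$ can be completed to a real null frame $\boldsymbol\ell, \boldsymbol n, \boldsymbol m^{(i)}$, $2\le i\le n-1$ ($\boldsymbol\ell,\boldsymbol n$ null, $\ell^a n_a=1$, $\boldsymbol m^{(i)}$ orthonormal, spacelike and orthogonal to $\boldsymbol\ell$ and $\boldsymbol n$), in which, with index $0$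 denoting contraction with $\boldsymbol\ell$, index $1$ contraction with $\boldsymbol n$, and indices $i,j,k,l$ contraction with the vectors $\boldsymbol m^{(i)}$, one has $C_{0i0j}=C_{0ijk}=C_{ijkl}=C_{01ij}=0$ and either * (type III(B)) some $C_{1ijk}\neq 0$ and $\tilde\Psi := \tfrac12 C_{1ijk}C_{1ijk} - C_{101i}C_{101i} = 0$ (summation over repeated frame indices), or * (type N) all $C_{1ijk}=0$ and some $C_{1i1j}\neq 0$. Put $$\mathcal B = \frac{\Lambda-\Lambda_0}{2\kappa} + \left(\frac{n-4}{(n-2)^2}(n\alpha+\beta) + \frac{(n-3)(n-4)}{(n-2)(n-1)}\gamma\right)\Lambda^2 ,$$ $$\mathcal A = \frac1\kappa + 4\Lambda\left(\frac{n\alpha}{n-2}+\frac{\beta}{n-1}+\frac{(n-3)(n-4)}{(n-2)(n-1)}\gamma\right).$$ If $\mathcal B = 0$ and $(\beta\Box+\mathcal A)(\Phi\,\ell_a\ell_b)=0$ on $M$, then $g$ solves the source-free field equations of quadratic gravity $$\begin{aligned} &\frac1\kappa\left(R_{ab}-\tfrac12 R g_{ab}+\Lambda_0 g_{ab}\right)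 + 2\alpha R\left(R_{ab}-\tfrac14 R g_{ab}\right) + (2\alpha+\beta)\left(g_{ab}\Box-\nabla_a\nabla_b\right)R\\ &\quad + 2\gamma\Big(R R_{ab}-2R_{acbd}R^{cd}+R_{acde}R_b{}^{cde}-2R_{ac}R_b{}^c-\tfrac14 g_{ab}\big(R_{cdef}R^{cdef}-4R_{cd}R^{cd}+R^2\big)\Big)\\ &\quad + \beta\Box\left(R_{ab}-\tfrac12 R g_{ab}\right) + 2\beta\left(R_{acbd}-\tfrac14 g_{ab}R_{cd}\right)R^{cd} = 0 . \end{aligned}$$ -/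

import Mathlib

open scoped Manifold ContDiff

noncomputable section

namespace QuadGrav

/-! ## Tensor calculus in coordinates

Tensor fields on a coordinate domain are given by their components. `G x a b` are the covariant
components of the metric at the coordinate point `x`. -/

/-- The coordinate space `ℝⁿ`. -/
abbrev Coord (n : ℕ) := EuclideanSpace ℝ (Fin n)

/-- Partial derivative `∂_a f`. -/
def pd {n : ℕ} (a : Fin n) (f : Coord n → ℝ) (x : Coord n) : ℝ :=
  fderiv ℝ f x (EuclideanSpace.single a 1)

/-- Christoffel symbols `Γ^c_{ab} = ½ g^{cd} (∂_a g_{db} + ∂_b g_{da} - ∂_d g_{ab})`. -/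
def christoffel {n : ℕ} (G : Coord n → Matrix (Fin n) (Fin n) ℝ) (c a b : Fin n)
    (x : Coord n) : ℝ :=
  (1 / 2) * ∑ d, (G x)⁻¹ c d *
    (pd a (fun y => G y d b) x + pd b (fun y => G y d a) x - pd d (fun y => G y a b) x)

/-- Curvature `R^a_{bcd} = ∂_c Γ^a_{db} - ∂_d Γ^a_{cb} + Γ^a_{ce} Γ^e_{db} - Γ^a_{de} Γ^e_{cb}`;
this is the convention `v_{a;bc} - v_{a;cb} = R^d_{abc} v_d`. -/
def riemannUp {n : ℕ} (G : Coord n → Matrix (Fin n) (Fin n) ℝ) (a b c d : Fin n)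
    (x : Coord n) : ℝ :=
  pd c (christoffel G a d b) x - pd d (christoffel G a c b) x
    + ∑ e, (christoffel G a c e x * christoffel G e d b x
      - christoffel G a d e x * christoffel G e c b x)

/-- Covariant Riemann tensor `R_{abcd} = g_{ae} R^e_{bcd}`. -/
def riemann {n : ℕ} (G : Coord n → Matrix (Fin n) (Fin n) ℝ) (a b c d : Fin n)
    (x : Coord n) : ℝ :=
  ∑ e, G x a e * riemannUp G e b c d x

/-- Ricci tensor `R_{ab} = R^c_{acb}`. -/
def ricci {n : ℕ} (G : Coord n → Matrix (Fin n) (Fin n) ℝ) (a b : Fin n) (x : Coord n) : ℝ :=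
  ∑ c, riemannUp G c a c b x

/-- Scalar curvature `R = g^{ab} R_{ab}`. -/
def scalarCurv {n : ℕ} (G : Coord n → Matrix (Fin n) (Fin n) ℝ) (x : Coord n) : ℝ :=
  ∑ a, ∑ b, (G x)⁻¹ a b * ricci G a b x

/-- Weyl tensor
`C_{abcd} = R_{abcd} - 2/(n-2) (g_{a[c} R_{d]b} - g_{b[c} R_{d]a})
  + 2/((n-1)(n-2)) R g_{a[c} g_{d]b}`. -/
def weyl {n : ℕ} (G : Coord n → Matrix (Fin n) (Fin n) ℝ) (a b c d : Fin n)
    (x : Coord n) : ℝ :=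
  riemann G a b c d x
    - 1 / ((n : ℝ) - 2) * (G x a c * ricci G d b x - G x a d * ricci G c b x
        - G x b c * ricci G d a x + G x b d * ricci G c a x)
    + 1 / (((n : ℝ) - 1) * ((n : ℝ) - 2)) * scalarCurv G x
        * (G x a c * G x d b - G x a d * G x c b)

/-- `∇_a ∇_b f` for a function `f`. -/
def hess {n : ℕ} (G : Coord n → Matrix (Fin n) (Fin n) ℝ) (f : Coord n → ℝ) (a b : Fin n)
    (x : Coord n) : ℝ :=
  pd a (pd b f) x - ∑ c, christoffel G c a b x * pd c f x

/-- `□ f = g^{ab} ∇_a ∇_b f` for a function `f`. -/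
def boxScalar {n : ℕ} (G : Coord n → Matrix (Fin n) (Fin n) ℝ) (f : Coord n → ℝ)
    (x : Coord n) : ℝ :=
  ∑ a, ∑ b, (G x)⁻¹ a b * hess G f a b x

/-- `∇_c T_{ab}` for a covariant tensor field of rank two. -/
def covDeriv2 {n : ℕ} (G : Coord n → Matrix (Fin n) (Fin n) ℝ)
    (T : Fin n → Fin n → Coord n → ℝ) (c a b : Fin n) (x : Coord n) : ℝ :=
  pd c (T a b) x - ∑ d, christoffel G d c a x * T d b x - ∑ d, christoffel G d c b x * T a d x

/-- `∇_d T_{cab}` for a covariant tensor field of rank three. -/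
def covDeriv3 {n : ℕ} (G : Coord n → Matrix (Fin n) (Fin n) ℝ)
    (T : Fin n → Fin n → Fin n → Coord n → ℝ) (d c a b : Fin n) (x : Coord n) : ℝ :=
  pd d (T c a b) x - ∑ e, christoffel G e d c x * T e a b x
    - ∑ e, christoffel G e d a x * T c e b x - ∑ e, christoffel G e d b x * T c a e x

/-- `□ T_{ab} = g^{dc} ∇_d ∇_c T_{ab}` for a covariant tensor field of rank two. -/
def boxTensor {n : ℕ} (G : Coord n → Matrix (Fin n) (Fin n) ℝ)
    (T : Fin n → Fin n → Coord n → ℝ) (a b : Fin n) (x : Coord n) : ℝ :=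
  ∑ d, ∑ c, (G x)⁻¹ d c * covDeriv3 G (covDeriv2 G T) d c a b x

/-- `R^{ab}`. -/
def ricciUpUp {n : ℕ} (G : Coord n → Matrix (Fin n) (Fin n) ℝ) (a b : Fin n)
    (x : Coord n) : ℝ :=
  ∑ c, ∑ d, (G x)⁻¹ a c * (G x)⁻¹ b d * ricci G c d x

/-- `R_{cd} R^{cd}`. -/
def ricciSq {n : ℕ} (G : Coord n → Matrix (Fin n) (Fin n) ℝ) (x : Coord n) : ℝ :=
  ∑ c, ∑ d, ricci G c d x * ricciUpUp G c d x

/-- `R_{acbd} R^{cd}`. -/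
def riemannRicci {n : ℕ} (G : Coord n → Matrix (Fin n) (Fin n) ℝ) (a b : Fin n)
    (x : Coord n) : ℝ :=
  ∑ c, ∑ d, riemann G a c b d x * ricciUpUp G c d x

/-- `R_{ac} R_b^c`. -/
def ricciRicci {n : ℕ} (G : Coord n → Matrix (Fin n) (Fin n) ℝ) (a b : Fin n)
    (x : Coord n) : ℝ :=
  ∑ c, ∑ d, (G x)⁻¹ c d * ricci G a c x * ricci G b d x

/-- `R_{acde} R_b^{cde}`. -/
def riemannRiemann {n : ℕ} (G : Coord n → Matrix (Fin n) (Fin n) ℝ) (a b : Fin n)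
    (x : Coord n) : ℝ :=
  ∑ c, ∑ d, ∑ e, ∑ c', ∑ d', ∑ e', (G x)⁻¹ c c' * (G x)⁻¹ d d' * (G x)⁻¹ e e'
    * riemann G a c d e x * riemann G b c' d' e' x

/-- `R_{cdef} R^{cdef}`. -/
def riemannSq {n : ℕ} (G : Coord n → Matrix (Fin n) (Fin n) ℝ) (x : Coord n) : ℝ :=
  ∑ a, ∑ b, (G x)⁻¹ a b * riemannRiemann G a b x

/-! ## Quadratic gravity -/

/-- The coupling constants of the quadratic gravity action. -/
structure Couplings where
  κ : ℝ
  Λ₀ : ℝ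
  α : ℝ
  β : ℝ
  γ : ℝ

/-- Left-hand side of the source-free field equations of quadratic gravity:
```
1/κ (R_ab - ½ R g_ab + Λ₀ g_ab) + 2α R (R_ab - ¼ R g_ab) + (2α + β)(g_ab □ - ∇_a ∇_b) R
 + 2γ (R R_ab - 2 R_acbd R^cd + R_acde R_b^cde - 2 R_ac R_b^c
        - ¼ g_ab (R_cdef R^cdef - 4 R_cd R^cd + R²))
 + β □(R_ab - ½ R g_ab) + 2β (R_acbd - ¼ g_ab R_cd) R^cd
```
-/
def fieldTensor {n : ℕ} (P : Couplings) (G : Coord n → Matrix (Fin n) (Fin n) ℝ) (a b : Fin n)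
    (x : Coord n) : ℝ :=
  1 / P.κ * (ricci G a b x - 1 / 2 * scalarCurv G x * G x a b + P.Λ₀ * G x a b)
  + 2 * P.α * scalarCurv G x * (ricci G a b x - 1 / 4 * scalarCurv G x * G x a b)
  + (2 * P.α + P.β) *
      (G x a b * boxScalar G (scalarCurv G) x - hess G (scalarCurv G) a b x)
  + 2 * P.γ * (scalarCurv G x * ricci G a b x - 2 * riemannRicci G a b x
      + riemannRiemann G a b x - 2 * ricciRicci G a b x
      - 1 / 4 * G x a b * (riemannSq G x - 4 * ricciSq G x + scalarCurv G x ^ 2))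
  + P.β * boxTensor G (fun c d y => ricci G c d y - 1 / 2 * scalarCurv G y * G y c d) a b x
  + 2 * P.β * (riemannRicci G a b x - 1 / 4 * G x a b * ricciSq G x)

/-- `ε = (n-4)/(n-2)² (nα + β) + (n-3)(n-4)/((n-2)(n-1)) γ`. -/
def Couplings.eps (P : Couplings) (n : ℕ) : ℝ :=
  ((n : ℝ) - 4) / ((n : ℝ) - 2) ^ 2 * (n * P.α + P.β)
    + ((n : ℝ) - 3) * ((n : ℝ) - 4) / (((n : ℝ) - 2) * ((n : ℝ) - 1)) * P.γ

/-- `𝓑 = (Λ - Λ₀)/(2κ) + ε Λ²`. -/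
def Couplings.constB (P : Couplings) (n : ℕ) (Λ : ℝ) : ℝ :=
  (Λ - P.Λ₀) / (2 * P.κ) + P.eps n * Λ ^ 2

/-- `𝓐 = 1/κ + 4Λ (nα/(n-2) + β/(n-1) + (n-3)(n-4)/((n-2)(n-1)) γ)`. -/
def Couplings.constA (P : Couplings) (n : ℕ) (Λ : ℝ) : ℝ :=
  1 / P.κ + 4 * Λ * (n * P.α / ((n : ℝ) - 2) + P.β / ((n : ℝ) - 1)
    + ((n : ℝ) - 3) * ((n : ℝ) - 4) / (((n : ℝ) - 2) * ((n : ℝ) - 1)) * P.γ)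

/-! ## Null frames and Weyl types at a point

Here `g` is the matrix of the metric at a point, `C` are the coordinate components of the Weyl
tensor at that point, and vectors are given by their contravariant components. -/

/-- The scalar product `g_{ab} u^a v^b`. -/
def sp {n : ℕ} (g : Matrix (Fin n) (Fin n) ℝ) (u v : Fin n → ℝ) : ℝ :=
  ∑ a, ∑ b, g a b * u a * v b

/-- A real null frame: null vectors `ℓ`, `k` with `ℓ · k = 1` and `n - 2` orthonormal spacelike
vectors `m i` orthogonal to both. (The second null vector, usually `n`, is called `k` here.) -/
structure IsNullFrame {n : ℕ} (g : Matrix (Fin n) (Fin n) ℝ) (ℓ k : Fin n → ℝ)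
    (m : Fin (n - 2) → Fin n → ℝ) : Prop where
  null_ℓ : sp g ℓ ℓ = 0
  null_k : sp g k k = 0
  ℓ_k : sp g ℓ k = 1
  ℓ_m : ∀ i, sp g ℓ (m i) = 0
  k_m : ∀ i, sp g k (m i) = 0
  m_m : ∀ i j, sp g (m i) (m j) = if i = j then 1 else 0

/-- The component `C_{abcd} u^a v^b w^c z^d`. -/
def comp4 {n : ℕ} (C : Fin n → Fin n → Fin n → Fin n → ℝ) (u v w z : Fin n → ℝ) : ℝ :=
  ∑ a, ∑ b, ∑ c, ∑ d, C a b c d * u a * v b * w c * z d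

/-- `C_{0i0j} = C_{0ijk} = C_{ijkl} = C_{01ij} = 0`: all components of nonnegative boost weight
vanish (the index `0` stands for a contraction with `ℓ`, the index `1` for one with `k`). -/
structure OnlyNegativeBoostWeight {n : ℕ} (C : Fin n → Fin n → Fin n → Fin n → ℝ)
    (ℓ k : Fin n → ℝ) (m : Fin (n - 2) → Fin n → ℝ) : Prop where
  c_0i0j : ∀ i j, comp4 C ℓ (m i) ℓ (m j) = 0
  c_0ijk : ∀ i j l, comp4 C ℓ (m i) (m j) (m l) = 0
  c_ijkl : ∀ i j l p, comp4 C (m i) (m j) (m l) (m p) = 0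
  c_01ij : ∀ i j, comp4 C ℓ k (m i) (m j) = 0

/-- `Ψ̃ = ½ Ψ'_{ijk} Ψ'_{ijk} - Ψ'_i Ψ'_i` with `Ψ'_{ijk} = C_{1ijk}` and `Ψ'_i = C_{101i}`. -/
def psiTilde {n : ℕ} (C : Fin n → Fin n → Fin n → Fin n → ℝ)
    (ℓ k : Fin n → ℝ) (m : Fin (n - 2) → Fin n → ℝ) : ℝ :=
  1 / 2 * ∑ i, ∑ j, ∑ l, comp4 C k (m i) (m j) (m l) ^ 2 - ∑ i, comp4 C k ℓ k (m i) ^ 2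

/-- Weyl type III(B) with multiple Weyl aligned null direction `ℓ`: the components of nonnegative
boost weight vanish, some `C_{1ijk}` does not, and `Ψ̃ = 0`. -/
def WeylTypeIIIB {n : ℕ} (g : Matrix (Fin n) (Fin n) ℝ)
    (C : Fin n → Fin n → Fin n → Fin n → ℝ) (ℓ : Fin n → ℝ) : Prop :=
  ∃ (k : Fin n → ℝ) (m : Fin (n - 2) → Fin n → ℝ), IsNullFrame g ℓ k m ∧
    OnlyNegativeBoostWeight C ℓ k m ∧
    (∃ i j l, comp4 C k (m i) (m j) (m l) ≠ 0) ∧ psiTilde C ℓ k m = 0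

/-- Weyl type N with multiple Weyl aligned null direction `ℓ`: only components `C_{1i1j}` are
nonzero, and some of them are. -/
def WeylTypeN {n : ℕ} (g : Matrix (Fin n) (Fin n) ℝ)
    (C : Fin n → Fin n → Fin n → Fin n → ℝ) (ℓ : Fin n → ℝ) : Prop :=
  ∃ (k : Fin n → ℝ) (m : Fin (n - 2) → Fin n → ℝ), IsNullFrame g ℓ k m ∧
    OnlyNegativeBoostWeight C ℓ k m ∧
    (∀ i j l, comp4 C k (m i) (m j) (m l) = 0) ∧ ∃ i j, comp4 C k (m i) k (m j) ≠ 0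

/-- Weyl type O: the Weyl tensor vanishes. -/
def WeylTypeO {n : ℕ} (C : Fin n → Fin n → Fin n → Fin n → ℝ) : Prop :=
  ∀ a b c d, C a b c d = 0

/-! ## Spacetimes -/

/-- A smooth Lorentzian metric, of signature `(-, +, …, +)`, on an `n`-dimensional smooth
manifold `M`. -/
structure LorentzianMetric (n : ℕ) (M : Type*) [TopologicalSpace M]
    [ChartedSpace (EuclideanSpace ℝ (Fin n)) M] [IsManifold (𝓡 n) ∞ M] where
  inner (p : M) : TangentSpace (𝓡 n) p →L[ℝ] TangentSpace (𝓡 n) p →L[ℝ] ℝ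
  symm (p : M) (v w : TangentSpace (𝓡 n) p) : inner p v w = inner p w v
  signature (p : M) : ∃ b : Module.Basis (Fin n) ℝ (TangentSpace (𝓡 n) p), ∀ i j,
    inner p (b i) (b j) = if i = j then (if (i : ℕ) = 0 then -1 else 1) else 0
  contMDiff : ContMDiff (𝓡 n) ((𝓡 n).prod 𝓘(ℝ, Coord n →L[ℝ] Coord n →L[ℝ] ℝ)) ∞
    (fun p => Bundle.TotalSpace.mk' (Coord n →L[ℝ] Coord n →L[ℝ] ℝ) p (inner p) :
      M → Bundle.TotalSpace (Coord n →L[ℝ] Coord n →L[ℝ] ℝ)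
        (fun p : M => TangentSpace (𝓡 n) p →L[ℝ] TangentSpace (𝓡 n) p →L[ℝ] ℝ))

section Spacetime

variable {n : ℕ} {M : Type*} [TopologicalSpace M]
  [ChartedSpace (EuclideanSpace ℝ (Fin n)) M] [IsManifold (𝓡 n) ∞ M]

/-- The coordinate vector `∂_a` of the chart `e` at the point with coordinates `x`. -/
def coordVector (e : OpenPartialHomeomorph M (EuclideanSpace ℝ (Fin n))) (a : Fin n)
    (x : Coord n) : TangentSpace (𝓡 n) (e.symm x) :=
  mfderiv (𝓡 n) (𝓡 n) e.symm x (EuclideanSpace.single a (1 : ℝ) : EuclideanSpace ℝ (Fin n))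

/-- The components `g_{ab}` of the metric in the chart `e`. -/
def LorentzianMetric.coord (g : LorentzianMetric n M)
    (e : OpenPartialHomeomorph M (EuclideanSpace ℝ (Fin n))) (x : Coord n) :
    Matrix (Fin n) (Fin n) ℝ :=
  Matrix.of fun a b => g.inner (e.symm x) (coordVector e a x) (coordVector e b x)

/-- The contravariant components `ℓ^a` of a vector field in the chart `e`. -/
def upComp (e : OpenPartialHomeomorph M (EuclideanSpace ℝ (Fin n)))
    (ℓ : ∀ p : M, TangentSpace (𝓡 n) p) (x : Coord n) (a : Fin n) : ℝ :=
  let v : Coord n := mfderiv (𝓡 n) (𝓡 n) e (e.symm x) (ℓ (e.symm x))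
  v a

/-- The components `Φ ℓ_a ℓ_b`, with `ℓ_a = g_{ac} ℓ^c`, in the chart `e`. -/
def LorentzianMetric.nullRadiation (g : LorentzianMetric n M) (Φ : M → ℝ)
    (ℓ : ∀ p : M, TangentSpace (𝓡 n) p)
    (e : OpenPartialHomeomorph M (EuclideanSpace ℝ (Fin n))) (a b : Fin n) (x : Coord n) : ℝ :=
  Φ (e.symm x) * (∑ c, g.coord e x a c * upComp e ℓ x c)
    * (∑ c, g.coord e x b c * upComp e ℓ x c)

/-- `ℓ` is a (nowhere vanishing) null vector field. -/
def LorentzianMetric.IsNullField (g : LorentzianMetric n M)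
    (ℓ : ∀ p : M, TangentSpace (𝓡 n) p) : Prop :=
  ∀ p, ℓ p ≠ 0 ∧ g.inner p (ℓ p) (ℓ p) = 0

/-- At each point the Weyl tensor is of type III(B) or N with multiple Weyl aligned null
direction `ℓ`, or of type O. -/
def LorentzianMetric.HasWeylTypeIIIBorNorO (g : LorentzianMetric n M)
    (ℓ : ∀ p : M, TangentSpace (𝓡 n) p) : Prop :=
  ∀ e ∈ IsManifold.maximalAtlas (𝓡 n) ∞ M, ∀ x ∈ e.target,
    WeylTypeIIIB (g.coord e x) (fun a b c d => weyl (g.coord e) a b c d x) (upComp e ℓ x) ∨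
    WeylTypeN (g.coord e x) (fun a b c d => weyl (g.coord e) a b c d x) (upComp e ℓ x) ∨
    WeylTypeO (fun a b c d => weyl (g.coord e) a b c d x)

/-- `R_{ab} = 2Λ/(n-2) g_{ab} + Φ ℓ_a ℓ_b`. -/
def LorentzianMetric.HasNullRadiationRicci (g : LorentzianMetric n M) (Λ : ℝ) (Φ : M → ℝ)
    (ℓ : ∀ p : M, TangentSpace (𝓡 n) p) : Prop :=
  ∀ e ∈ IsManifold.maximalAtlas (𝓡 n) ∞ M, ∀ x ∈ e.target, ∀ a b,
    ricci (g.coord e) a b x =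
      2 * Λ / ((n : ℝ) - 2) * g.coord e x a b + g.nullRadiation Φ ℓ e a b x

/-- `(β □ + A) (Φ ℓ_a ℓ_b) = 0`. -/
def LorentzianMetric.NullRadiationEquation (g : LorentzianMetric n M) (β A : ℝ) (Φ : M → ℝ)
    (ℓ : ∀ p : M, TangentSpace (𝓡 n) p) : Prop :=
  ∀ e ∈ IsManifold.maximalAtlas (𝓡 n) ∞ M, ∀ x ∈ e.target, ∀ a b,
    β * boxTensor (g.coord e) (g.nullRadiation Φ ℓ e) a b x
      + A * g.nullRadiation Φ ℓ e a b x = 0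

/-- The metric solves the source-free field equations of quadratic gravity. -/
def LorentzianMetric.SolvesVacuumQuadraticGravity (g : LorentzianMetric n M)
    (P : Couplings) : Prop :=
  ∀ e ∈ IsManifold.maximalAtlas (𝓡 n) ∞ M, ∀ x ∈ e.target, ∀ a b,
    fieldTensor P (g.coord e) a b x = 0

end Spacetime

end QuadGrav

end

/-!
Write `λ = 2Λ/(n-2)` and `S_{ab} = Φ ℓ_a ℓ_b`, so that `R_{ab} = λ g_{ab} + S_{ab}`. As `ℓ` is null,
`S` is trace-free, hence the scalar curvature is the constant `nλ`, its derivatives drop out of the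
field equations, and metric compatibility gives `□(R_{ab} - ½ R g_{ab}) = □ S_{ab}`. What remains is
algebra at a point.

The curvature splits as `Rm = C + g ∧ P`, where `∧` is the Kulkarni–Nomizu product, `C` the Weyl
tensor and `P = λ/(2(n-1)) g + S/(n-2)` the Schouten tensor. The Weyl type enters only through

* `C_{acbd} ℓ^c ℓ^d = 0` and
* `C_{acde} C_b{}^{cde} = 0`,

see `contr_eq_zero_of_weylType`. Both follow by counting boost weights. For a trace-free curvature
tensor the assumed vanishing of some frame components implies that all components of nonnegative
boost weight vanish (`eq_zero_of_boostWeight_nonneg`). In the quadratic contraction dual frame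
vectors have opposite weights, so the two factors in the component along `u`, `v` have total weight
`w(u) + w(v)`; unless both `u` and `v` are the second null vector `k`, one factor vanishes, and the
remaining component is `2 Ψ̃` (`sum_mul_dualIdx_eq_zero`).

With these facts the quadratic contractions of `Rm` reduce to the identity
`T_{acde} (g ∧ P)_b{}^{cde} = 2 T_{acbd} P^{cd} - 2 T_{ac}{}^c{}_d P^d{}_b` (`contr3_kulkarni`), and
they are all combinations of `g` and `S`. The field equations become
`-2 𝓑 g_{ab} + (β □ + 𝓐) S_{ab} = 0`; see `fieldTensor_eq_zero`.

The symmetries of the curvature tensor are derived in coordinates from the definition by Christoffel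
symbols, and `LorentzianMetric.isMetricOn_coord` provides the smooth nondegenerate coordinate metric.
-/

noncomputable section

namespace QuadGrav

variable {n : ℕ}

/-! ### Contractions with the inverse metric -/

/-- The contraction `g^{ab} f_{ab}`; `h` is the inverse metric. -/
def contr (h : Matrix (Fin n) (Fin n) ℝ) (f : Fin n → Fin n → ℝ) : ℝ :=
  ∑ a, ∑ b, h a b * f a b

lemma contr_add (h : Matrix (Fin n) (Fin n) ℝ) (f f' : Fin n → Fin n → ℝ) :
    contr h (fun a b => f a b + f' a b) = contr h f + contr h f' := by
  simp only [contr, mul_add, Finset.sum_add_distrib]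

lemma contr_sub (h : Matrix (Fin n) (Fin n) ℝ) (f f' : Fin n → Fin n → ℝ) :
    contr h (fun a b => f a b - f' a b) = contr h f - contr h f' := by
  simp only [contr, mul_sub, Finset.sum_sub_distrib]

lemma contr_const_mul (h : Matrix (Fin n) (Fin n) ℝ) (r : ℝ) (f : Fin n → Fin n → ℝ) :
    contr h (fun a b => r * f a b) = r * contr h f := by
  simp only [contr, Finset.mul_sum]
  exact Finset.sum_congr rfl fun a _ => Finset.sum_congr rfl fun b _ => by ring

lemma contr_mul_const (h : Matrix (Fin n) (Fin n) ℝ) (r : ℝ) (f : Fin n → Fin n → ℝ) :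
    contr h (fun a b => f a b * r) = contr h f * r := by
  simp only [mul_comm _ r, contr_const_mul]

lemma contr_neg (h : Matrix (Fin n) (Fin n) ℝ) (f : Fin n → Fin n → ℝ) :
    contr h (fun a b => -f a b) = -contr h f := by
  simp only [contr, mul_neg, Finset.sum_neg_distrib]

lemma contr_zero (h : Matrix (Fin n) (Fin n) ℝ) : contr h (fun _ _ => 0) = 0 := by
  simp [contr]

lemma contr_sum {ι : Type*} [Fintype ι] (h : Matrix (Fin n) (Fin n) ℝ)
    (f : ι → Fin n → Fin n → ℝ) :
    contr h (fun a b => ∑ i, f i a b) = ∑ i, contr h (f i) := by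
  simp only [contr, Finset.mul_sum]
  calc _ = ∑ a, ∑ i, ∑ b, h a b * f i a b := Finset.sum_congr rfl fun a _ => Finset.sum_comm
    _ = _ := Finset.sum_comm

lemma contr_swap {h : Matrix (Fin n) (Fin n) ℝ} (hh : h.IsSymm) (f : Fin n → Fin n → ℝ) :
    contr h (fun a b => f b a) = contr h f := by
  unfold contr
  rw [Finset.sum_comm]
  exact Finset.sum_congr rfl fun a _ => Finset.sum_congr rfl fun b _ => by rw [hh.apply]

lemma contr_comm (h : Matrix (Fin n) (Fin n) ℝ) (f : Fin n → Fin n → Fin n → Fin n → ℝ) :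
    contr h (fun a b => contr h fun c d => f a b c d)
      = contr h (fun c d => contr h fun a b => f a b c d) := by
  simp only [contr, Finset.mul_sum]
  calc _ = ∑ a, ∑ b, ∑ c, ∑ d, h a b * (h c d * f a b c d) := rfl
    _ = ∑ a, ∑ c, ∑ b, ∑ d, h a b * (h c d * f a b c d) :=
        Finset.sum_congr rfl fun a _ => Finset.sum_comm
    _ = ∑ c, ∑ a, ∑ b, ∑ d, h a b * (h c d * f a b c d) := Finset.sum_comm
    _ = ∑ c, ∑ a, ∑ d, ∑ b, h a b * (h c d * f a b c d) :=
        Finset.sum_congr rfl fun c _ => Finset.sum_congr rfl fun a _ => Finset.sum_comm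
    _ = ∑ c, ∑ d, ∑ a, ∑ b, h a b * (h c d * f a b c d) :=
        Finset.sum_congr rfl fun c _ => Finset.sum_comm
    _ = _ := by
        refine Finset.sum_congr rfl fun c _ => Finset.sum_congr rfl fun d _ =>
          Finset.sum_congr rfl fun a _ => Finset.sum_congr rfl fun b _ => by ring

/-- Contracting a slot with the metric renames the index. -/
lemma contr_mul_metric {g h : Matrix (Fin n) (Fin n) ℝ} (hgh : h * g = 1)
    (f : Fin n → ℝ) (x : Fin n) : contr h (fun a b => f a * g b x) = f x := by
  have key : ∀ a, ∑ b, h a b * (f a * g b x) = f a * (1 : Matrix (Fin n) (Fin n) ℝ) a x := by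
    intro a
    rw [← hgh, Matrix.mul_apply, Finset.mul_sum]
    exact Finset.sum_congr rfl fun b _ => by ring
  simp only [contr, key, Matrix.one_apply, mul_ite, mul_one, mul_zero, Finset.sum_ite_eq',
    Finset.mem_univ, if_true]

lemma contr_metric {g h : Matrix (Fin n) (Fin n) ℝ} (hg : g.IsSymm) (hgh : h * g = 1) :
    contr h g = n := by
  have key : ∀ a, ∑ b, h a b * g a b = 1 := by
    intro a
    have := congrFun (congrFun hgh a) a
    rw [Matrix.mul_apply, Matrix.one_apply_eq] at this
    rw [← this]
    exact Finset.sum_congr rfl fun b _ => by rw [hg.apply]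
  simp [contr, key]

/-- Contracting a slot with `ℓ_a` evaluates it at the vector `ℓ^a`. -/
lemma contr_mul_lower {g h : Matrix (Fin n) (Fin n) ℝ} (hgh : h * g = 1)
    (f : Fin n → ℝ) (v : Fin n → ℝ) :
    contr h (fun a b => f a * ∑ c, g b c * v c) = ∑ c, f c * v c := by
  have : ∀ a b, f a * ∑ c, g b c * v c = ∑ c, f a * g b c * v c := fun a b => by
    rw [Finset.mul_sum]; exact Finset.sum_congr rfl fun c _ => by ring
  simp only [this]
  rw [contr_sum]
  refine Finset.sum_congr rfl fun c _ => ?_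
  rw [contr_mul_const, contr_mul_metric hgh]

/-- `T_{acde} U_b{}^{cde}`. -/
def contr3 (h : Matrix (Fin n) (Fin n) ℝ) (T U : Fin n → Fin n → Fin n → Fin n → ℝ)
    (a b : Fin n) : ℝ :=
  contr h fun c c' => contr h fun d d' => contr h fun e e' => T a c d e * U b c' d' e'

lemma contr3_add_right (h : Matrix (Fin n) (Fin n) ℝ)
    (T U U' : Fin n → Fin n → Fin n → Fin n → ℝ) (a b : Fin n) :
    contr3 h T (fun a b c d => U a b c d + U' a b c d) a b
      = contr3 h T U a b + contr3 h T U' a b := by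
  simp only [contr3, mul_add, contr_add]

lemma contr3_swap {h : Matrix (Fin n) (Fin n) ℝ} (hh : h.IsSymm)
    (T U : Fin n → Fin n → Fin n → Fin n → ℝ) (a b : Fin n) :
    contr3 h T U a b = contr3 h U T b a := by
  unfold contr3
  rw [← contr_swap hh]
  congr 1; ext c c'
  rw [← contr_swap hh]
  congr 1; ext d d'
  rw [← contr_swap hh]
  congr 1; ext e e'
  ring

/-- The Kulkarni–Nomizu product of `g` with a symmetric tensor `P`. -/
def kulkarni (g : Matrix (Fin n) (Fin n) ℝ) (P : Fin n → Fin n → ℝ) (a b c d : Fin n) : ℝ :=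
  g a c * P d b - g a d * P c b - g b c * P d a + g b d * P c a

/-- For `T` antisymmetric in its second pair of indices,
`T_{acde} (g ∧ P)_b{}^{cde} = 2 T_{acbd} P^{cd} - 2 T_{ac}{}^c{}_d P^d{}_b`. -/
lemma contr3_kulkarni {g h : Matrix (Fin n) (Fin n) ℝ} (hg : g.IsSymm)
    (hgh : h * g = 1) {T : Fin n → Fin n → Fin n → Fin n → ℝ}
    (hT : ∀ a b c d, T a b d c = -T a b c d) (P : Fin n → Fin n → ℝ)
    (hP : ∀ a b, P a b = P b a) (a b : Fin n) :
    contr3 h T (kulkarni g P) a b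
      = 2 * contr h (fun c c' => contr h fun d d' => T a c b d * P c' d')
        - 2 * contr h (fun e e' => contr h (fun c c' => T a c c' e) * P e' b) := by
  have t1 : contr h (fun c c' => contr h fun d d' => contr h fun e e' =>
      T a c d e * (g b d' * P e' c'))
      = contr h (fun c c' => contr h fun d d' => T a c b d * P c' d') := by
    congr 1; ext c c'
    rw [contr_comm]
    congr 1; ext e e'
    have : ∀ d d', T a c d e * (g b d' * P e' c') = (T a c d e * P c' e') * g d' b := by
      intro d d'; rw [hg.apply, hP c']; ring
    simp only [this]
    rw [contr_mul_metric hgh (fun d => T a c d e * P c' e')]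
  have t2 : contr h (fun c c' => contr h fun d d' => contr h fun e e' =>
      T a c d e * (g b e' * P d' c'))
      = -contr h (fun c c' => contr h fun d d' => T a c b d * P c' d') := by
    rw [← contr_neg]
    congr 1; ext c c'
    rw [← contr_neg]
    congr 1; ext d d'
    have : ∀ e e', T a c d e * (g b e' * P d' c') = (T a c d e * P c' d') * g e' b := by
      intro e e'; rw [hg.apply, hP c']; ring
    simp only [this]
    rw [contr_mul_metric hgh (fun e => T a c d e * P c' d'), hT]
    ring
  have t3 : contr h (fun c c' => contr h fun d d' => contr h fun e e' =>
      T a c d e * (g c' d' * P e' b))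
      = contr h (fun e e' => contr h (fun c c' => T a c c' e) * P e' b) := by
    have : ∀ c c', contr h (fun d d' => contr h fun e e' => T a c d e * (g c' d' * P e' b))
        = contr h (fun e e' => T a c c' e * P e' b) := by
      intro c c'
      rw [contr_comm]
      congr 1; ext e e'
      have : ∀ d d', T a c d e * (g c' d' * P e' b) = (T a c d e * P e' b) * g d' c' := by
        intro d d'; rw [hg.apply]; ring
      simp only [this]
      rw [contr_mul_metric hgh (fun d => T a c d e * P e' b)]
    simp only [this]
    rw [contr_comm]
    simp only [contr_mul_const]
  have t4 : contr h (fun c c' => contr h fun d d' => contr h fun e e' =>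
      T a c d e * (g c' e' * P d' b))
      = -contr h (fun e e' => contr h (fun c c' => T a c c' e) * P e' b) := by
    have : ∀ c c', contr h (fun d d' => contr h fun e e' => T a c d e * (g c' e' * P d' b))
        = contr h (fun e e' => -(T a c c' e * P e' b)) := by
      intro c c'
      congr 1; ext d d'
      have : ∀ e e', T a c d e * (g c' e' * P d' b) = (T a c d e * P d' b) * g e' c' := by
        intro e e'; rw [hg.apply]; ring
      simp only [this]
      rw [contr_mul_metric hgh (fun e => T a c d e * P d' b), hT]
      ring
    simp only [this, contr_neg]
    rw [contr_comm]
    simp only [contr_mul_const]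
  unfold contr3 kulkarni
  simp only [mul_add, mul_sub, contr_add, contr_sub]
  rw [t1, t2, t3, t4]
  ring

/-! ### Null frames -/

/-- Labels of the vectors of a null frame: `ℓ`, `k`, and the `n - 2` spacelike vectors. -/
abbrev FrameIdx (n : ℕ) := Fin 2 ⊕ Fin (n - 2)

/-- The vectors of a null frame as one family. -/
def frameVec (ℓ k : Fin n → ℝ) (m : Fin (n - 2) → Fin n → ℝ) : FrameIdx n → Fin n → ℝ :=
  Sum.elim ![ℓ, k] m

/-- The label of the dual frame vector: `ℓ` and `k` are exchanged. -/
def dualIdx : FrameIdx n → FrameIdx n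
  | .inl i => .inl (1 - i)
  | .inr i => .inr i

/-- The boost weight of a frame vector. -/
def boostWeight : FrameIdx n → ℤ
  | .inl i => if i = 0 then 1 else -1
  | .inr _ => 0

lemma dualIdx_dualIdx (i : FrameIdx n) : dualIdx (dualIdx i) = i := by
  rcases i with i | i
  · fin_cases i <;> rfl
  · rfl

lemma dualIdx_inj {i j : FrameIdx n} : dualIdx i = dualIdx j ↔ i = j :=
  ⟨fun e => by rw [← dualIdx_dualIdx i, e, dualIdx_dualIdx], fun e => by rw [e]⟩

lemma boostWeight_dualIdx (i : FrameIdx n) : boostWeight (dualIdx i) = -boostWeight i := by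
  rcases i with i | i
  · fin_cases i <;> simp [dualIdx, boostWeight]
  · rfl

lemma sp_comm {g : Matrix (Fin n) (Fin n) ℝ} (hg : g.IsSymm) (u v : Fin n → ℝ) :
    sp g u v = sp g v u := by
  unfold sp
  rw [Finset.sum_comm]
  refine Finset.sum_congr rfl fun a _ => Finset.sum_congr rfl fun b _ => ?_
  rw [hg.apply]; ring

/-- The Gram matrix of a null frame is the permutation matrix of `dualIdx`. -/
lemma IsNullFrame.sp_frameVec {g : Matrix (Fin n) (Fin n) ℝ} (hg : g.IsSymm)
    {ℓ k : Fin n → ℝ} {m : Fin (n - 2) → Fin n → ℝ} (hF : IsNullFrame g ℓ k m)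
    (i j : FrameIdx n) :
    sp g (frameVec ℓ k m i) (frameVec ℓ k m j) = if j = dualIdx i then 1 else 0 := by
  rcases i with i | i <;> rcases j with j | j
  · fin_cases i <;> fin_cases j <;>
      simp [frameVec, dualIdx, hF.null_ℓ, hF.null_k, hF.ℓ_k, sp_comm hg k ℓ]
  · fin_cases i <;> simp [frameVec, dualIdx, hF.ℓ_m, hF.k_m]
  · fin_cases j <;> simp [frameVec, dualIdx, sp_comm hg (m i), hF.ℓ_m, hF.k_m]
  · simp [frameVec, dualIdx, hF.m_m, eq_comm]

/-- Completeness of a null frame: `g^{ab} = ℓ^a k^b + k^a ℓ^b + m_i^a m_i^b`. -/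
lemma IsNullFrame.inverse_metric (hn : 2 ≤ n) {g h : Matrix (Fin n) (Fin n) ℝ} (hg : g.IsSymm)
    (hgh : h * g = 1)
    {ℓ k : Fin n → ℝ} {m : Fin (n - 2) → Fin n → ℝ} (hF : IsNullFrame g ℓ k m) (a b : Fin n) :
    h a b = ∑ i, frameVec ℓ k m i a * frameVec ℓ k m (dualIdx i) b := by
  let X : Matrix (FrameIdx n) (Fin n) ℝ := Matrix.of (frameVec ℓ k m)
  let Y : Matrix (FrameIdx n) (Fin n) ℝ := Matrix.of fun i => frameVec ℓ k m (dualIdx i)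
  have h1 : X * (g * Y.transpose) = 1 := by
    ext i j
    have := hF.sp_frameVec hg i (dualIdx j)
    simp only [dualIdx_inj, eq_comm (a := j)] at this
    rw [Matrix.one_apply, ← this, Matrix.mul_apply]
    simp only [Matrix.mul_apply, sp, Finset.mul_sum, X, Y, Matrix.of_apply,
      Matrix.transpose_apply]
    exact Finset.sum_congr rfl fun a _ => Finset.sum_congr rfl fun b _ => by ring
  have h2 : (g * Y.transpose) * X = 1 := by
    rw [Matrix.mul_eq_one_comm_of_card_eq]
    · exact h1
    · simp; omega
  have h3 : h = Y.transpose * X := by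
    calc h = h * ((g * Y.transpose) * X) := by rw [h2, mul_one]
      _ = (h * g) * (Y.transpose * X) := by simp only [Matrix.mul_assoc]
      _ = _ := by rw [hgh, one_mul]
  rw [h3, Matrix.mul_apply]
  let σ : Equiv.Perm (FrameIdx n) := ⟨dualIdx, dualIdx, dualIdx_dualIdx, dualIdx_dualIdx⟩
  rw [← Equiv.sum_comp σ]
  exact Finset.sum_congr rfl fun i _ => by simp [X, Y, σ, dualIdx_dualIdx]

lemma contr_mul_of_frame {ι : Type*} [Fintype ι] {h : Matrix (Fin n) (Fin n) ℝ}
    {E E' : ι → Fin n → ℝ} (hE : ∀ a b, h a b = ∑ i, E i a * E' i b) (A B : Fin n → ℝ) :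
    contr h (fun a b => A a * B b) = ∑ i, (∑ a, A a * E i a) * ∑ b, B b * E' i b := by
  simp only [Finset.sum_mul_sum]
  simp only [contr, hE, Finset.sum_mul]
  calc _ = ∑ a, ∑ i, ∑ b, E i a * E' i b * (A a * B b) :=
        Finset.sum_congr rfl fun a _ => Finset.sum_comm
    _ = ∑ i, ∑ a, ∑ b, E i a * E' i b * (A a * B b) := Finset.sum_comm
    _ = _ := Finset.sum_congr rfl fun i _ => Finset.sum_congr rfl fun a _ =>
        Finset.sum_congr rfl fun b _ => by ring

lemma comp4_eq (C : Fin n → Fin n → Fin n → Fin n → ℝ) (u v w z : Fin n → ℝ) :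
    comp4 C u v w z
      = ∑ a, (∑ b, (∑ c, (∑ d, C a b c d * z d) * w c) * v b) * u a := by
  simp only [comp4, Finset.sum_mul]
  refine Finset.sum_congr rfl fun a _ => Finset.sum_congr rfl fun b _ =>
    Finset.sum_congr rfl fun c _ => Finset.sum_congr rfl fun d _ => by ring

lemma sum_sum_mul_sum {ι : Type*} [Fintype ι] (A B : ι → ι → ι → Fin n → ℝ) (u v : Fin n → ℝ) :
    ∑ a, ∑ b, (∑ i, ∑ j, ∑ l, A i j l a * B i j l b) * u a * v b
      = ∑ i, ∑ j, ∑ l, (∑ a, A i j l a * u a) * ∑ b, B i j l b * v b := by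
  simp only [Finset.sum_mul_sum]
  simp only [Finset.sum_mul]
  have push : ∀ f : Fin n → Fin n → ι → ℝ,
      ∑ a, ∑ b, ∑ i, f a b i = ∑ i, ∑ a, ∑ b, f a b i := fun f => by
    rw [Finset.sum_comm (s := (Finset.univ : Finset ι))]
    exact Finset.sum_congr rfl fun a _ => Finset.sum_comm
  rw [push]
  refine Finset.sum_congr rfl fun i _ => ?_
  rw [push]
  refine Finset.sum_congr rfl fun j _ => ?_
  rw [push]
  exact Finset.sum_congr rfl fun l _ => Finset.sum_congr rfl fun a _ =>
    Finset.sum_congr rfl fun b _ => by ring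

/-- Each contraction in `T_{acde} U_b{}^{cde}` is evaluated in a complete frame `E` with dual
frame `E'`. -/
lemma sum_contr3_of_frame {ι : Type*} [Fintype ι] {h : Matrix (Fin n) (Fin n) ℝ}
    {E E' : ι → Fin n → ℝ} (hE : ∀ a b, h a b = ∑ i, E i a * E' i b)
    (T U : Fin n → Fin n → Fin n → Fin n → ℝ) (u v : Fin n → ℝ) :
    ∑ a, ∑ b, contr3 h T U a b * u a * v b
      = ∑ i, ∑ j, ∑ l, comp4 T u (E l) (E j) (E i) * comp4 U v (E' l) (E' j) (E' i) := by
  simp only [contr3, contr_mul_of_frame hE, contr_sum, comp4_eq]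
  exact sum_sum_mul_sum _ _ u v

/-! ### Boost weights and the Weyl type -/

/-- The two antisymmetries and the cyclic identity of a curvature tensor. -/
structure IsCurvatureLike {ι : Type*} (D : ι → ι → ι → ι → ℝ) : Prop where
  anti_left : ∀ a b c d, D b a c d = -D a b c d
  anti_right : ∀ a b c d, D a b d c = -D a b c d
  cyclic : ∀ a b c d, D a b c d + D a c d b + D a d b c = 0

/-- The pair symmetry is a signed sum of four cyclic identities. -/
lemma IsCurvatureLike.pair_symm {ι : Type*} {D : ι → ι → ι → ι → ℝ} (hD : IsCurvatureLike D)
    (a b c d : ι) : D c d a b = D a b c d := by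
  have l := hD.anti_left
  have r := hD.anti_right
  have e1 := hD.cyclic a b c d
  have e2 := hD.cyclic b c d a
  have e3 := hD.cyclic c d a b
  have e4 := hD.cyclic d a b c
  linarith [l a b c d, l a b d c, r a b c d, l a c d b, l a c b d, r a c d b, l a d b c, l a d c b,
    r a d b c, l b c d a, l b c a d, r b c d a, l b d a c, l b d c a, r b d a c, l c d a b,
    l c d b a, r c d a b]

section Frame

variable {h : Matrix (Fin n) (Fin n) ℝ} {C : Fin n → Fin n → Fin n → Fin n → ℝ}

lemma IsCurvatureLike.comp4 (hC : IsCurvatureLike C) {ι : Type*} (E : ι → Fin n → ℝ) :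
    IsCurvatureLike fun i j k l => comp4 C (E i) (E j) (E k) (E l) where
  anti_left i j k l := by
    simp only [QuadGrav.comp4, ← Finset.sum_neg_distrib]
    rw [Finset.sum_comm]
    refine Finset.sum_congr rfl fun a _ => Finset.sum_congr rfl fun b _ =>
      Finset.sum_congr rfl fun c _ => Finset.sum_congr rfl fun d _ => ?_
    rw [hC.anti_left]; ring
  anti_right i j k l := by
    simp only [QuadGrav.comp4, ← Finset.sum_neg_distrib]
    refine Finset.sum_congr rfl fun a _ => Finset.sum_congr rfl fun b _ => ?_
    rw [Finset.sum_comm]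
    refine Finset.sum_congr rfl fun c _ => Finset.sum_congr rfl fun d _ => ?_
    rw [hC.anti_right]; ring
  cyclic i j k l := by
    simp only [QuadGrav.comp4, ← Finset.sum_add_distrib]
    refine Finset.sum_eq_zero fun a _ => ?_
    have rot : ∀ f : Fin n → Fin n → Fin n → ℝ,
        ∑ b, ∑ c, ∑ d, f b c d = ∑ b, ∑ c, ∑ d, f c d b := fun f => by
      conv_rhs => rw [Finset.sum_comm]
      exact Finset.sum_congr rfl fun b _ => Finset.sum_comm
    have e2 := rot fun b c d => C a b c d * E i a * E k b * E l c * E j d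
    have e3 := rot fun b c d => C a c d b * E i a * E l c * E j d * E k b
    have e3' := rot fun b c d => C a b c d * E i a * E l b * E j c * E k d
    simp only [Finset.sum_add_distrib]
    rw [e2, e3', e3]
    simp only [← Finset.sum_add_distrib]
    refine Finset.sum_eq_zero fun b _ => Finset.sum_eq_zero fun c _ =>
      Finset.sum_eq_zero fun d _ => ?_
    linear_combination (E i a * E j b * E k c * E l d) * hC.cyclic a b c d

/-- The trace-free condition in terms of frame components. -/
lemma sum_comp4_of_frame {ι : Type*} [Fintype ι] {E E' : ι → Fin n → ℝ}
    (hE : ∀ a b, h a b = ∑ i, E i a * E' i b)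
    (hC : ∀ b d, contr h (fun a c => C a b c d) = 0) (v z : Fin n → ℝ) :
    ∑ i, comp4 C (E i) v (E' i) z = 0 := by
  have h1 : ∑ i, comp4 C (E i) v (E' i) z
      = ∑ a, ∑ b, ∑ c, ∑ d, h a c * C a b c d * (v b * z d) := by
    simp only [comp4, hE, Finset.sum_mul]
    rw [Finset.sum_comm]
    refine Finset.sum_congr rfl fun a _ => ?_
    rw [Finset.sum_comm]
    refine Finset.sum_congr rfl fun b _ => ?_
    rw [Finset.sum_comm]
    refine Finset.sum_congr rfl fun c _ => ?_
    rw [Finset.sum_comm]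
    refine Finset.sum_congr rfl fun d _ => Finset.sum_congr rfl fun i _ => by ring
  have h2 : ∑ a, ∑ b, ∑ c, ∑ d, h a c * C a b c d * (v b * z d)
      = ∑ b, ∑ d, contr h (fun a c => C a b c d) * (v b * z d) := by
    simp only [contr, Finset.sum_mul]
    rw [Finset.sum_comm]
    refine Finset.sum_congr rfl fun b _ => ?_
    conv_rhs => rw [Finset.sum_comm]
    refine Finset.sum_congr rfl fun a _ => Finset.sum_comm
  rw [h1, h2]
  simp [hC]

end Frame

/-- For a trace-free curvature tensor the vanishing of `C_{0i0j}`, `C_{0ijk}`, `C_{ijkl}` and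
`C_{01ij}` forces all frame components of nonnegative boost weight to vanish: the trace and cyclic
identities give `C_{0i1j} = C_{0101} = C_{010i} = 0`. -/
lemma eq_zero_of_boostWeight_nonneg {D : FrameIdx n → FrameIdx n → FrameIdx n → FrameIdx n → ℝ}
    (hD : IsCurvatureLike D) (htr : ∀ b d, ∑ i, D i b (dualIdx i) d = 0)
    (h1 : ∀ i j, D (.inl 0) (.inr i) (.inl 0) (.inr j) = 0)
    (h2 : ∀ i j l, D (.inl 0) (.inr i) (.inr j) (.inr l) = 0)
    (h3 : ∀ i j l p, D (.inr i) (.inr j) (.inr l) (.inr p) = 0)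
    (h4 : ∀ i j, D (.inl 0) (.inl 1) (.inr i) (.inr j) = 0)
    (a b c d : FrameIdx n)
    (hw : 0 ≤ boostWeight a + boostWeight b + boostWeight c + boostWeight d) :
    D a b c d = 0 := by
  have L := hD.anti_left
  have R := hD.anti_right
  have Y := hD.pair_symm
  have htr' : ∀ b d, D (.inl 0) b (.inl 1) d + D (.inl 1) b (.inl 0) d
      + ∑ i, D (.inr i) b (.inr i) d = 0 := by
    intro b d
    have := htr b d
    rw [Fintype.sum_sum_type, Fin.sum_univ_two] at this
    exact this
  have h5 : ∀ i j, D (.inl 0) (.inr i) (.inl 1) (.inr j) = 0 := by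
    intro i j
    have t := htr' (.inr i) (.inr j)
    simp only [h3, Finset.sum_const_zero] at t
    have c := hD.cyclic (.inl 0) (.inl 1) (.inr i) (.inr j)
    rw [h4, R _ _ (.inl 1) (.inr j)] at c
    rw [Y (.inl 0) (.inr j)] at t
    linarith
  have h6 : D (.inl 0) (.inl 1) (.inl 0) (.inl 1) = 0 := by
    have t := htr' (.inl 0) (.inl 1)
    have s : ∀ i, D (.inr i) (.inl 0) (.inr i) (.inl 1) = 0 := by
      intro i; rw [L, R, h5]; simp
    simp only [s, Finset.sum_const_zero] at t
    linarith [L (.inl 0) (.inl 0) (.inl 1) (.inl 1), L (.inl 0) (.inl 1) (.inl 0) (.inl 1)]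
  have h7 : ∀ i, D (.inl 0) (.inl 1) (.inl 0) (.inr i) = 0 := by
    intro i
    have t := htr' (.inl 0) (.inr i)
    have s : ∀ j, D (.inr j) (.inl 0) (.inr j) (.inr i) = 0 := by
      intro j; rw [L, h2]; simp
    simp only [s, Finset.sum_const_zero] at t
    linarith [L (.inl 0) (.inl 0) (.inl 1) (.inr i), L (.inl 0) (.inl 1) (.inl 0) (.inr i)]
  have e1 := L a b c d
  have e2 := R a b c d
  have e3 := R b a c d
  have e4 := Y a b c d
  have e5 := L c d a b
  have e6 := R c d a b
  have e7 := L c d b a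
  have two : ∀ i : Fin 2, i = 0 ∨ i = 1 := by decide
  rcases a with a | a <;> rcases b with b | b <;> rcases c with c | c <;> rcases d with d | d <;>
    (try rcases two a with rfl | rfl) <;> (try rcases two b with rfl | rfl) <;>
    (try rcases two c with rfl | rfl) <;> (try rcases two d with rfl | rfl) <;>
    first
    | (exfalso; simp [boostWeight] at hw; done)
    | linarith
    | (simp only [h1, h2, h3, h4, h5, h7] at e1 e2 e3 e4 e5 e6 e7 ⊢ <;> linarith)

/-- A product of two components of total boost weight at least `-1` has a factor of nonnegative
boost weight; the contraction `C_{acde} C_b{}^{cde}` pairs dual indices, so only its component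
`C_{1cde} C_1{}^{cde}` can survive, and that one equals `2 Ψ̃`. -/
lemma sum_mul_dualIdx_eq_zero
    {D : FrameIdx n → FrameIdx n → FrameIdx n → FrameIdx n → ℝ} (hD : IsCurvatureLike D)
    (hw : ∀ a b c d, 0 ≤ boostWeight a + boostWeight b + boostWeight c + boostWeight d →
      D a b c d = 0)
    (hΨ : 1 / 2 * ∑ i, ∑ j, ∑ l, D (.inl 1) (.inr i) (.inr j) (.inr l) ^ 2
      - ∑ i, D (.inl 1) (.inl 0) (.inl 1) (.inr i) ^ 2 = 0) (u v : FrameIdx n) :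
    ∑ i, ∑ j, ∑ l, D u l j i * D v (dualIdx l) (dualIdx j) (dualIdx i) = 0 := by
  -- the two factors have total weight `w(u) + w(v)`, so above `-2` one of them is nonnegative
  by_cases huv : -1 ≤ boostWeight u + boostWeight v
  · refine Finset.sum_eq_zero fun i _ => Finset.sum_eq_zero fun j _ =>
      Finset.sum_eq_zero fun l _ => ?_
    by_cases h0 : 0 ≤ boostWeight u + boostWeight l + boostWeight j + boostWeight i
    · rw [hw _ _ _ _ h0, zero_mul]
    · rw [hw v, mul_zero]
      simp only [boostWeight_dualIdx]
      omega
  have two : ∀ i : Fin 2, i = 0 ∨ i = 1 := by decide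
  have hu : u = .inl 1 := by
    rcases u with u | u <;> rcases v with v | v <;>
    (try rcases two u with rfl | rfl) <;> (try rcases two v with rfl | rfl) <;>
    simp [boostWeight] at huv ⊢
  have hv : v = .inl 1 := by
    rcases u with u | u <;> rcases v with v | v <;>
    (try rcases two u with rfl | rfl) <;> (try rcases two v with rfl | rfl) <;>
    simp [boostWeight] at huv ⊢
  subst hu hv
  have L := hD.anti_left
  have R := hD.anti_right
  have Y := hD.pair_symm
  have z : ∀ b c d, 1 ≤ boostWeight b + boostWeight c + boostWeight d → D (.inl 1) b c d = 0 := by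
    intro b c d h
    apply hw
    have hb : boostWeight (.inl 1 : FrameIdx n) = -1 := rfl
    omega
  have f1 : ∀ c d, D (.inl 1) (.inl 1) c d = 0 := fun c d => by
    have := L (.inl 1) (.inl 1) c d; linarith
  have f2 : ∀ a b c, D a b c c = 0 := fun a b c => by
    have := R a b c c; linarith
  have f3 : ∀ i j, D (.inl 1) (.inr i) (.inl 0) (.inr j) = 0 := fun i j => z _ _ _ (by
    simp [boostWeight])
  have f4 : ∀ i j, D (.inl 1) (.inr i) (.inr j) (.inl 0) = 0 := fun i j => z _ _ _ (by
    simp [boostWeight])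
  have f5 : ∀ i, D (.inl 1) (.inr i) (.inl 0) (.inl 1) = -D (.inl 1) (.inl 0) (.inl 1) (.inr i) :=
    fun i => by rw [← Y (.inl 1) (.inr i), L (.inl 1) (.inl 0)]
  have f6 : ∀ i, D (.inl 1) (.inr i) (.inl 1) (.inl 0) = D (.inl 1) (.inl 0) (.inl 1) (.inr i) :=
    fun i => Y _ _ _ _
  have d0 : dualIdx (.inl 0 : FrameIdx n) = .inl 1 := rfl
  have d1 : dualIdx (.inl 1 : FrameIdx n) = .inl 0 := rfl
  have d2 : ∀ i, dualIdx (.inr i : FrameIdx n) = .inr i := fun _ => rfl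
  simp only [Fintype.sum_sum_type, Fin.sum_univ_two, d0, d1, d2, f1, f2, f3, f4, f5, f6]
  simp only [mul_zero, zero_mul, add_zero, zero_add, Finset.sum_const_zero]
  have swap : ∑ i, ∑ j, ∑ l, D (.inl 1) (.inr l) (.inr j) (.inr i) ^ 2
      = ∑ i, ∑ j, ∑ l, D (.inl 1) (.inr i) (.inr j) (.inr l) ^ 2 := by
    calc _ = ∑ i, ∑ l, ∑ j, D (.inl 1) (.inr l) (.inr j) (.inr i) ^ 2 :=
          Finset.sum_congr rfl fun i _ => Finset.sum_comm
      _ = ∑ l, ∑ i, ∑ j, D (.inl 1) (.inr l) (.inr j) (.inr i) ^ 2 := Finset.sum_comm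
      _ = _ := Finset.sum_congr rfl fun i _ => Finset.sum_comm
  simp only [mul_neg, neg_mul, Finset.sum_neg_distrib, ← pow_two]
  rw [swap]
  linarith

/-- A bilinear form that vanishes on the vectors of a complete frame vanishes. -/
lemma eq_zero_of_frame {ι : Type*} [Fintype ι] {g h : Matrix (Fin n) (Fin n) ℝ}
    (hgh : h * g = 1) {E E' : ι → Fin n → ℝ} (hE : ∀ a b, h a b = ∑ i, E i a * E' i b)
    (q : Fin n → Fin n → ℝ) (hq : ∀ i j, ∑ a, ∑ b, q a b * E i a * E j b = 0) (a b : Fin n) :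
    q a b = 0 := by
  let Q : Matrix (Fin n) (Fin n) ℝ := Matrix.of q
  let X : Matrix ι (Fin n) ℝ := Matrix.of E
  let Y : Matrix ι (Fin n) ℝ := Matrix.of E'
  have hX : X.transpose * (Y * g) = 1 := by
    rw [← Matrix.mul_assoc, ← hgh]
    congr 1
    ext a b
    rw [hE, Matrix.mul_apply]
    rfl
  have hQ : X * Q * X.transpose = 0 := by
    ext i j
    rw [Matrix.zero_apply, ← hq i j, Matrix.mul_apply]
    simp only [Matrix.mul_apply, Finset.sum_mul, X, Q, Matrix.of_apply, Matrix.transpose_apply]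
    rw [Finset.sum_comm]
    exact Finset.sum_congr rfl fun a _ => Finset.sum_congr rfl fun b _ => by ring
  have : Q = 0 := by
    calc Q = (X.transpose * (Y * g)).transpose * Q * (X.transpose * (Y * g)) := by
          rw [hX, Matrix.transpose_one, one_mul, mul_one]
      _ = (Y * g).transpose * (X * Q * X.transpose) * (Y * g) := by
          simp only [Matrix.transpose_mul, Matrix.transpose_transpose, Matrix.mul_assoc]
      _ = 0 := by rw [hQ]; simp
  exact congrFun (congrFun this a) b

/-- The consequences of the Weyl type that enter the field equations: `C_{acbd} ℓ^c ℓ^d = 0` and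
`C_{acde} C_b{}^{cde} = 0`. -/
lemma OnlyNegativeBoostWeight.contr_eq_zero (hn : 2 ≤ n) {g h : Matrix (Fin n) (Fin n) ℝ}
    (hg : g.IsSymm) (hgh : h * g = 1) {C : Fin n → Fin n → Fin n → Fin n → ℝ}
    (hC : IsCurvatureLike C) (htr : ∀ b d, contr h (fun a c => C a b c d) = 0)
    {ℓ k : Fin n → ℝ} {m : Fin (n - 2) → Fin n → ℝ} (hF : IsNullFrame g ℓ k m)
    (hW : OnlyNegativeBoostWeight C ℓ k m) (hΨ : psiTilde C ℓ k m = 0) (a b : Fin n) :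
    contr3 h C C a b = 0 ∧ ∑ c, ∑ d, C a c b d * ℓ c * ℓ d = 0 := by
  have hE := hF.inverse_metric hn hg hgh
  set E := frameVec ℓ k m with hE_def
  have hD := hC.comp4 E
  have hw := eq_zero_of_boostWeight_nonneg hD (fun b d => sum_comp4_of_frame hE htr (E b) (E d))
    hW.c_0i0j hW.c_0ijk hW.c_ijkl hW.c_01ij
  constructor
  · refine eq_zero_of_frame hgh hE _ (fun u v => ?_) a b
    rw [sum_contr3_of_frame hE]
    exact sum_mul_dualIdx_eq_zero hD hw hΨ u v
  · refine eq_zero_of_frame hgh hE (fun a b => ∑ c, ∑ d, C a c b d * ℓ c * ℓ d) (fun u v => ?_) a b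
    have h0 : comp4 C (E u) (E (.inl 0)) (E v) (E (.inl 0)) = 0 := by
      apply hw
      rcases u with u | u <;> rcases v with v | v <;> simp [boostWeight] <;> split_ifs <;> omega
    rw [← h0]
    simp only [comp4, Finset.sum_mul]
    refine Finset.sum_congr rfl fun a _ => ?_
    rw [Finset.sum_comm]
    refine Finset.sum_congr rfl fun c _ => Finset.sum_congr rfl fun b _ =>
      Finset.sum_congr rfl fun d _ => ?_
    simp only [hE_def, frameVec, Sum.elim_inl, Matrix.cons_val_zero]
    ring

lemma contr_eq_zero_of_weylType (hn : 2 ≤ n) {g h : Matrix (Fin n) (Fin n) ℝ}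
    (hg : g.IsSymm) (hgh : h * g = 1) {C : Fin n → Fin n → Fin n → Fin n → ℝ}
    (hC : IsCurvatureLike C) (htr : ∀ b d, contr h (fun a c => C a b c d) = 0)
    {ℓ : Fin n → ℝ} (hW : WeylTypeIIIB g C ℓ ∨ WeylTypeN g C ℓ ∨ WeylTypeO C) (a b : Fin n) :
    contr3 h C C a b = 0 ∧ ∑ c, ∑ d, C a c b d * ℓ c * ℓ d = 0 := by
  rcases hW with ⟨k, m, hF, hW, -, hΨ⟩ | ⟨k, m, hF, hW, h0, -⟩ | hO
  · exact hW.contr_eq_zero hn hg hgh hC htr hF hΨ a b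
  · refine hW.contr_eq_zero hn hg hgh hC htr hF ?_ a b
    -- the trace of `C_{a1ci}` over `a`, `c` shows that `C_{101i}` vanishes along with `C_{1ijk}`
    have hE := hF.inverse_metric hn hg hgh
    have h1 : ∀ i, comp4 C k ℓ k (m i) = 0 := by
      intro i
      have t := sum_comp4_of_frame hE htr k (m i)
      rw [Fintype.sum_sum_type, Fin.sum_univ_two] at t
      have L := (hC.comp4 (frameVec ℓ k m)).anti_left
      have s : ∀ j, comp4 C (m j) k (m j) (m i) = 0 := by
        intro j
        have := L (.inl 1) (.inr j) (.inr j) (.inr i)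
        simp only [frameVec, Sum.elim_inl, Sum.elim_inr, Matrix.cons_val_one,
          Matrix.cons_val_zero] at this
        rw [this, h0, neg_zero]
      have s2 := L (.inl 1) (.inl 1) (.inl 0) (.inr i)
      have s3 := L (.inl 1) (.inl 0) (.inl 1) (.inr i)
      simp only [frameVec, dualIdx, Sum.elim_inl, Sum.elim_inr, Matrix.cons_val_one,
        Matrix.cons_val_zero, s, Finset.sum_const_zero, sub_zero, sub_self] at t s2 s3
      linarith
    simp [psiTilde, h0, h1]
  · simp [contr3, hO _ _ _ _, contr_zero]

/-! ### Curvature contractions for null radiation at a point -/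

lemma IsCurvatureLike.sub {ι : Type*} {D D' : ι → ι → ι → ι → ℝ} (hD : IsCurvatureLike D)
    (hD' : IsCurvatureLike D') : IsCurvatureLike fun a b c d => D a b c d - D' a b c d where
  anti_left a b c d := by rw [hD.anti_left, hD'.anti_left]; ring
  anti_right a b c d := by rw [hD.anti_right, hD'.anti_right]; ring
  cyclic a b c d := by linear_combination hD.cyclic a b c d - hD'.cyclic a b c d

lemma isCurvatureLike_kulkarni {g : Matrix (Fin n) (Fin n) ℝ} (hg : g.IsSymm)
    {P : Fin n → Fin n → ℝ} (hP : ∀ a b, P a b = P b a) : IsCurvatureLike (kulkarni g P) where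
  anti_left a b c d := by unfold kulkarni; ring
  anti_right a b c d := by unfold kulkarni; ring
  cyclic a b c d := by
    unfold kulkarni
    rw [hP d b, hP c b, hP d a, hP c a, hP c d, hP b a, hg.apply c d, hg.apply b c, hg.apply b d]
    ring

lemma contr_kulkarni {g h : Matrix (Fin n) (Fin n) ℝ} (hg : g.IsSymm) (hh : h.IsSymm)
    (hgh : h * g = 1) {P : Fin n → Fin n → ℝ} (hP : ∀ a b, P a b = P b a) (b d : Fin n) :
    contr h (fun a c => kulkarni g P a b c d) = (n - 2) * P b d + contr h P * g b d := by
  have e1 : contr h (fun a c => g a d * P c b) = P d b := by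
    rw [← contr_swap hh]
    simp only [mul_comm (g _ _)]
    exact contr_mul_metric hgh (fun a => P a b) d
  have e2 : contr h (fun a c => g b c * P d a) = P d b := by
    have : ∀ a c, g b c * P d a = P d a * g c b := fun a c => by rw [hg.apply, mul_comm]
    simp only [this]
    exact contr_mul_metric hgh (fun a => P d a) b
  have e3 : contr h (fun a c => g a c * P d b) = n * P d b := by
    rw [← contr_metric hg hgh]; exact contr_mul_const h (P d b) g
  unfold kulkarni
  rw [contr_add, contr_sub, contr_sub, contr_const_mul, e1, e2, e3, contr_swap hh, hP d b]
  ring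

/-- The Schouten tensor of a metric with Ricci tensor `λ g + S`, `S` trace-free. -/
abbrev schouten (g : Matrix (Fin n) (Fin n) ℝ) (lam : ℝ) (S : Fin n → Fin n → ℝ) (a b : Fin n) :
    ℝ :=
  lam / (2 * (n - 1)) * g a b + 1 / (n - 2) * S a b

lemma schouten_comm {g : Matrix (Fin n) (Fin n) ℝ} (hg : g.IsSymm) {lam : ℝ}
    {S : Fin n → Fin n → ℝ} (hS : ∀ a b, S a b = S b a) (a b : Fin n) :
    schouten g lam S a b = schouten g lam S b a := by
  unfold schouten; rw [hS, hg.apply]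

/-- A curvature tensor at a point, with Ricci tensor `λ g_{ab} + φ ℓ_a ℓ_b` for a null vector `ℓ`
such that the Weyl tensor `C` satisfies `C_{acbd} ℓ^c ℓ^d = 0` and `C_{acde} C_b{}^{cde} = 0`.
Here `Rm = C + g ∧ P` with `P` the Schouten tensor. -/
structure IsNullRadiationCurvature (g h : Matrix (Fin n) (Fin n) ℝ) (ℓ : Fin n → ℝ) (lam φ : ℝ)
    (S : Fin n → Fin n → ℝ) (Rm C : Fin n → Fin n → Fin n → Fin n → ℝ) : Prop where
  symm_g : g.IsSymm
  symm_h : h.IsSymm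
  inv : h * g = 1
  curv : IsCurvatureLike Rm
  S_eq : ∀ a b, S a b = φ * (∑ c, g a c * ℓ c) * ∑ c, g b c * ℓ c
  null : sp g ℓ ℓ = 0
  ric : ∀ b d, contr h (fun a c => Rm a b c d) = lam * g b d + S b d
  decomp : ∀ a b c d, Rm a b c d = C a b c d
    + kulkarni g (schouten g lam S) a b c d
  weyl_curv : IsCurvatureLike C
  weyl_trace : ∀ b d, contr h (fun a c => C a b c d) = 0
  weyl_ℓ : ∀ a b, ∑ c, ∑ d, C a c b d * ℓ c * ℓ d = 0
  weyl_weyl : ∀ a b, contr3 h C C a b = 0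

section

variable {g h : Matrix (Fin n) (Fin n) ℝ} {ℓ : Fin n → ℝ} {lam φ : ℝ} {S : Fin n → Fin n → ℝ}

lemma sp_eq (v : Fin n → ℝ) : sp g v v = ∑ a, (∑ c, g a c * v c) * v a := by
  simp only [sp, Finset.sum_mul]
  exact Finset.sum_congr rfl fun a _ => Finset.sum_congr rfl fun b _ => by ring

lemma contr_null (hgh : h * g = 1) (hS : ∀ a b, S a b = φ * (∑ c, g a c * ℓ c) * ∑ c, g b c * ℓ c)
    (hℓ : sp g ℓ ℓ = 0) : contr h S = 0 := by
  have : S = fun a b => (φ * (∑ c, g a c * ℓ c)) * ∑ c, g b c * ℓ c := by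
    ext a b; exact hS a b
  rw [this, contr_mul_lower hgh (fun a => φ * (∑ c, g a c * ℓ c))]
  rw [sp_eq] at hℓ
  simp only [mul_assoc, ← Finset.mul_sum]
  rw [hℓ, mul_zero]

lemma contr_null_null (hgh : h * g = 1)
    (hS : ∀ a b, S a b = φ * (∑ c, g a c * ℓ c) * ∑ c, g b c * ℓ c)
    (hℓ : sp g ℓ ℓ = 0) (a b : Fin n) : contr h (fun c d => S a c * S d b) = 0 := by
  have : ∀ c d, S a c * S d b = (φ * (∑ i, g a i * ℓ i) * (φ * (∑ i, g b i * ℓ i))) *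
      ((∑ i, g c i * ℓ i) * ∑ i, g d i * ℓ i) := by
    intro c d; rw [hS, hS]; ring
  simp only [this]
  rw [contr_const_mul, contr_mul_lower hgh (fun a => ∑ i, g a i * ℓ i), ← sp_eq, hℓ, mul_zero]

lemma contr_contr_null (hgh : h * g = 1)
    (hS : ∀ a b, S a b = φ * (∑ c, g a c * ℓ c) * ∑ c, g b c * ℓ c)
    (T : Fin n → Fin n → ℝ) :
    contr h (fun c c' => contr h fun d d' => T c d * S c' d')
      = φ * ∑ c, ∑ d, T c d * ℓ c * ℓ d := by
  have h1 : ∀ c c', contr h (fun d d' => T c d * S c' d')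
      = φ * ((∑ d, T c d * ℓ d) * ∑ i, g c' i * ℓ i) := by
    intro c c'
    have : ∀ d d', T c d * S c' d' = (φ * (∑ i, g c' i * ℓ i)) * (T c d * ∑ i, g d' i * ℓ i) := by
      intro d d'; rw [hS]; ring
    simp only [this]
    rw [contr_const_mul, contr_mul_lower hgh (T c)]
    ring
  simp only [h1]
  rw [contr_const_mul, contr_mul_lower hgh (fun c => ∑ d, T c d * ℓ d)]
  simp only [Finset.sum_mul]
  congr 1
  exact Finset.sum_congr rfl fun c _ => Finset.sum_congr rfl fun d _ => by ring

lemma contr_contr_metric (hg : g.IsSymm) (hgh : h * g = 1) (T : Fin n → Fin n → ℝ) :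
    contr h (fun c c' => contr h fun d d' => T c d * g c' d') = contr h T := by
  congr 1; ext c c'
  have : ∀ d d', T c d * g c' d' = T c d * g d' c' := fun d d' => by rw [hg.apply]
  simp only [this]
  exact contr_mul_metric hgh (T c) c'

end

namespace IsNullRadiationCurvature

variable {g h : Matrix (Fin n) (Fin n) ℝ} {ℓ : Fin n → ℝ} {lam φ : ℝ} {S : Fin n → Fin n → ℝ}
  {Rm C : Fin n → Fin n → Fin n → Fin n → ℝ}

lemma symm_S (H : IsNullRadiationCurvature g h ℓ lam φ S Rm C) (a b : Fin n) : S a b = S b a := by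
  rw [H.S_eq, H.S_eq]; ring

lemma symm_schouten (H : IsNullRadiationCurvature g h ℓ lam φ S Rm C) (a b : Fin n) :
    schouten g lam S a b = schouten g lam S b a := schouten_comm H.symm_g H.symm_S a b

lemma lower_contr (H : IsNullRadiationCurvature g h ℓ lam φ S Rm C) (a b : Fin n) :
    contr h (fun c d => S a c * g d b) = S a b := contr_mul_metric H.inv (S a) b

/-- `R_{acb}{}^c = R_{ab}`. -/
lemma contr_second (H : IsNullRadiationCurvature g h ℓ lam φ S Rm C) (a b : Fin n) :
    contr h (fun c d => Rm a c b d) = lam * g a b + S a b := by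
  rw [← H.ric]
  congr 1; ext c d
  rw [H.curv.anti_left c a b d, H.curv.anti_right c a d b, neg_neg]

/-- `R_{acbd} S^{cd} = -λ/(n-1) S_{ab}`. -/
lemma riemann_null (hn : 4 ≤ n) (H : IsNullRadiationCurvature g h ℓ lam φ S Rm C) (a b : Fin n) :
    contr h (fun c c' => contr h fun d d' => Rm a c b d * S c' d')
      = -(lam / (n - 1)) * S a b := by
  have hn1 : (n : ℝ) - 1 ≠ 0 := by
    have : (4 : ℝ) ≤ n := by exact_mod_cast hn
    intro h0; linarith
  rw [contr_contr_null H.inv H.S_eq]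
  set L : Fin n → ℝ := fun a => ∑ c, g a c * ℓ c
  have hℓ : ∑ c, L c * ℓ c = 0 := by rw [← sp_eq]; exact H.null
  have hSℓ : ∀ a, ∑ c, S a c * ℓ c = 0 := fun a => by
    have : ∀ c, S a c * ℓ c = φ * L a * (L c * ℓ c) := fun c => by rw [H.S_eq]; ring
    simp only [this, ← Finset.mul_sum, hℓ, mul_zero]
  have hPℓ : ∀ a, ∑ c, schouten g lam S a c * ℓ c = lam / (2 * (n - 1)) * L a := fun a => by
    have : ∀ c, schouten g lam S a c * ℓ c
        = lam / (2 * (n - 1)) * (g a c * ℓ c) + 1 / (n - 2) * (S a c * ℓ c) :=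
      fun c => by unfold schouten; ring
    simp only [this, Finset.sum_add_distrib, ← Finset.mul_sum, hSℓ, mul_zero, add_zero]
    rfl
  have hPℓℓ : ∑ c, (∑ d, schouten g lam S c d * ℓ d) * ℓ c = 0 := by
    simp only [hPℓ, mul_assoc, ← Finset.mul_sum, hℓ, mul_zero]
  have hgℓℓ : ∑ c, (∑ d, g c d * ℓ d) * ℓ c = 0 := hℓ
  have split : ∑ c, ∑ d, Rm a c b d * ℓ c * ℓ d
      = g a b * (∑ c, (∑ d, schouten g lam S c d * ℓ d) * ℓ c)
        - (∑ d, g a d * ℓ d) * (∑ c, schouten g lam S b c * ℓ c)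
        - (∑ c, g b c * ℓ c) * (∑ d, schouten g lam S a d * ℓ d)
        + (∑ c, (∑ d, g c d * ℓ d) * ℓ c) * schouten g lam S b a := by
    have e : ∀ c d, Rm a c b d * ℓ c * ℓ d = C a c b d * ℓ c * ℓ d
        + (g a b * (schouten g lam S c d * ℓ d * ℓ c)
        - (g a d * ℓ d) * (schouten g lam S b c * ℓ c)
        - (g b c * ℓ c) * (schouten g lam S a d * ℓ d)
        + (g c d * ℓ d * ℓ c) * schouten g lam S b a) := by
      intro c d
      rw [H.decomp]
      unfold kulkarni
      rw [H.symm_schouten d c, H.symm_schouten d a, H.symm_g.apply b c]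
      ring
    simp only [e, Finset.sum_add_distrib, Finset.sum_sub_distrib, H.weyl_ℓ, zero_add,
      ← Finset.mul_sum, ← Finset.sum_mul]
  rw [split, hPℓℓ, hgℓℓ, hPℓ, hPℓ, H.S_eq]
  change _ = -(lam / (n - 1)) * (φ * L a * L b)
  have : (2 : ℝ) * (n - 1) ≠ 0 := mul_ne_zero two_ne_zero hn1
  field_simp
  ring

/-- `R_{acbd} R^{cd}`. -/
lemma riemann_ricci (hn : 4 ≤ n) (H : IsNullRadiationCurvature g h ℓ lam φ S Rm C)
    (a b : Fin n) :
    contr h (fun c c' => contr h fun d d' => Rm a c b d * (lam * g c' d' + S c' d'))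
      = lam * (lam * g a b + S a b) - lam / (n - 1) * S a b := by
  have : ∀ c c' d d', Rm a c b d * (lam * g c' d' + S c' d')
      = lam * (Rm a c b d * g c' d') + Rm a c b d * S c' d' := fun _ _ _ _ => by ring
  simp only [this, contr_add, contr_const_mul]
  rw [contr_contr_metric H.symm_g H.inv, H.riemann_null hn, H.contr_second]
  ring

/-- `R_{acde} R_b{}^{cde}`. Since the Weyl tensor is trace-free with `C_{acbd} ℓ^c ℓ^d = 0` and
`C_{acde} C_b{}^{cde} = 0`, only the contraction of `Rm` with the Schouten part contributes. -/
lemma riemann_riemann (hn : 4 ≤ n) (H : IsNullRadiationCurvature g h ℓ lam φ S Rm C)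
    (a b : Fin n) :
    contr3 h Rm Rm a b = 2 * lam ^ 2 / (n - 1) * g a b + 4 * lam / (n - 1) * S a b := by
  have h4 : (4 : ℝ) ≤ n := by exact_mod_cast hn
  have hn1 : (n : ℝ) - 1 ≠ 0 := by intro h0; linarith
  have hn2 : (n : ℝ) - 2 ≠ 0 := by intro h0; linarith
  have hRm : Rm = fun a b c d => C a b c d + kulkarni g (schouten g lam S) a b c d := by
    ext a b c d; exact H.decomp a b c d
  have pairing : ∀ {T : Fin n → Fin n → Fin n → Fin n → ℝ}, (∀ a b, contr h (fun c c' =>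
      contr h fun d d' => T a c b d * schouten g lam S c' d')
      = lam / (2 * (n - 1)) * contr h (fun c d => T a c b d) + 1 / (n - 2) *
        contr h (fun c c' => contr h fun d d' => T a c b d * S c' d')) := by
    intro T a b
    rw [← contr_contr_metric H.symm_g H.inv (fun c d => T a c b d)]
    simp only [← contr_const_mul, ← contr_add]
    congr 1; ext c c'
    congr 1; ext d d'
    unfold schouten; ring
  -- the Weyl tensor is orthogonal to both parts of the Schouten tensor
  have hCS : ∀ a b, contr h (fun c c' => contr h fun d d' => C a c b d * S c' d') = 0 := by
    intro a b
    rw [contr_contr_null H.inv H.S_eq, H.weyl_ℓ, mul_zero]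
  have hCK : ∀ a b, contr3 h C (kulkarni g (schouten g lam S)) a b = 0 := by
    intro a b
    have t1 : contr h (fun c d => C a c b d) = 0 := by
      rw [← H.weyl_trace a b]
      congr 1; ext c d
      rw [H.weyl_curv.anti_left c a b d, H.weyl_curv.anti_right c a d b, neg_neg]
    have t2 : ∀ e, contr h (fun c c' => C a c c' e) = 0 := by
      intro e
      rw [← neg_eq_zero, ← contr_neg, ← H.weyl_trace a e]
      congr 1; ext c d
      rw [H.weyl_curv.anti_left c a d e, neg_neg]
    rw [contr3_kulkarni H.symm_g H.inv H.weyl_curv.anti_right _ H.symm_schouten, pairing, t1, hCS]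
    simp only [t2, zero_mul, contr_zero]
    ring
  have e1 : contr3 h Rm Rm a b
      = contr3 h Rm C a b + contr3 h Rm (kulkarni g (schouten g lam S)) a b := by
    conv_lhs => rw [show contr3 h Rm Rm = contr3 h Rm
      (fun a b c d => C a b c d + kulkarni g (schouten g lam S) a b c d) by rw [← hRm]]
    rw [contr3_add_right]
  have e2 : contr3 h Rm C a b = 0 := by
    rw [contr3_swap H.symm_h]
    conv_lhs => rw [hRm]
    rw [contr3_add_right, H.weyl_weyl, hCK, add_zero]
  have t2 : ∀ e, contr h (fun c c' => Rm a c c' e) = -(lam * g a e + S a e) := by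
    intro e
    rw [← H.ric, ← contr_neg]
    congr 1; ext c d
    rw [H.curv.anti_left]
  have t3 : contr h (fun e e' => -(lam * g a e + S a e) * schouten g lam S e' b)
      = -(lam * schouten g lam S a b + lam / (2 * (n - 1)) * S a b) := by
    have e : ∀ e e', -(lam * g a e + S a e) * schouten g lam S e' b
        = -(lam * (g e a * schouten g lam S b e') + lam / (2 * (n - 1)) * (S a e * g e' b)
          + 1 / (n - 2) * (S a e * S e' b)) := by
      intro e e'
      rw [H.symm_schouten b e', H.symm_g.apply]
      unfold schouten; ring
    have f : contr h (fun e e' => g e a * schouten g lam S b e') = schouten g lam S b a := by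
      rw [← contr_swap H.symm_h]
      simp only [mul_comm (g _ _)]
      exact contr_mul_metric H.inv _ _
    simp only [e]
    rw [contr_neg, contr_add, contr_add, contr_const_mul, contr_const_mul, contr_const_mul, f,
      H.lower_contr, contr_null_null H.inv H.S_eq H.null, H.symm_schouten]
    ring
  rw [e1, e2, contr3_kulkarni H.symm_g H.inv H.curv.anti_right _ H.symm_schouten, pairing,
    H.contr_second, H.riemann_null hn]
  simp only [t2]
  rw [t3]
  unfold schouten
  field_simp
  ring

/-- `R_{ac} R_b{}^c`. -/
lemma ricci_ricci (H : IsNullRadiationCurvature g h ℓ lam φ S Rm C) (a b : Fin n) :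
    contr h (fun c d => (lam * g a c + S a c) * (lam * g b d + S b d))
      = lam ^ 2 * g a b + 2 * lam * S a b := by
  have e : ∀ c d, (lam * g a c + S a c) * (lam * g b d + S b d)
      = lam * lam * (g a c * g d b) + lam * (S b d * g c a) + lam * (S a c * g d b)
        + S a c * S d b := by
    intro c d
    rw [H.symm_g.apply a c, H.symm_g.apply b d, H.symm_S d b]; ring
  have f : contr h (fun c d => S b d * g c a) = S b a := by
    rw [← contr_swap H.symm_h]; exact H.lower_contr b a
  have f2 : contr h (fun c d => g a c * g d b) = g a b := contr_mul_metric H.inv _ _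
  simp only [e]
  rw [contr_add, contr_add, contr_add, contr_const_mul, contr_const_mul, contr_const_mul, f, f2,
    H.lower_contr, contr_null_null H.inv H.S_eq H.null, H.symm_S b a]
  ring

end IsNullRadiationCurvature

/-! ### Metrics in coordinates -/

section PartialDerivatives

open scoped Topology

variable {f f' : Coord n → ℝ} {x : Coord n}

lemma pd_congr (h : f =ᶠ[𝓝 x] f') (a : Fin n) : pd a f x = pd a f' x := by
  unfold pd; rw [h.fderiv_eq]

lemma pd_const (r : ℝ) (a : Fin n) : pd a (fun _ => r) x = 0 := by
  simp [pd]

lemma pd_add (hf : DifferentiableAt ℝ f x) (hf' : DifferentiableAt ℝ f' x) (a : Fin n) :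
    pd a (fun y => f y + f' y) x = pd a f x + pd a f' x := by
  unfold pd; rw [fderiv_fun_add hf hf']; rfl

lemma pd_const_mul (hf : DifferentiableAt ℝ f x) (r : ℝ) (a : Fin n) :
    pd a (fun y => r * f y) x = r * pd a f x := by
  unfold pd; rw [fderiv_const_mul hf]; rfl

lemma pd_mul (hf : DifferentiableAt ℝ f x) (hf' : DifferentiableAt ℝ f' x) (a : Fin n) :
    pd a (fun y => f y * f' y) x = f x * pd a f' x + pd a f x * f' x := by
  unfold pd; rw [fderiv_fun_mul hf hf']
  simp [mul_comm]

lemma pd_sum {ι : Type*} {s : Finset ι} {F : ι → Coord n → ℝ}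
    (hF : ∀ i ∈ s, DifferentiableAt ℝ (F i) x) (a : Fin n) :
    pd a (fun y => ∑ i ∈ s, F i y) x = ∑ i ∈ s, pd a (F i) x := by
  unfold pd; rw [fderiv_fun_sum hF]; simp

lemma pd_comm (hf : ContDiffAt ℝ 2 f x) (a b : Fin n) : pd a (pd b f) x = pd b (pd a f) x := by
  have hd : DifferentiableAt ℝ (fderiv ℝ f) x :=
    (hf.fderiv_right (m := 1) (by norm_num)).differentiableAt (by norm_num)
  have key : ∀ a b : Fin n, pd a (pd b f) x
      = fderiv ℝ (fderiv ℝ f) x (EuclideanSpace.single a 1) (EuclideanSpace.single b 1) := by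
    intro a b
    change fderiv ℝ (fun y => fderiv ℝ f y (EuclideanSpace.single b 1)) x _ = _
    rw [fderiv_clm_apply hd (differentiableAt_const _)]
    simp
  rw [key, key]
  exact (hf.isSymmSndFDerivAt (by simp)).eq _ _

lemma contDiffOn_pd {U : Set (Coord n)} (hU : IsOpen U) (hf : ContDiffOn ℝ ∞ f U) (a : Fin n) :
    ContDiffOn ℝ ∞ (pd a f) U := by
  have h := hf.fderiv_of_isOpen hU (m := ∞) (by simp)
  exact h.clm_apply contDiffOn_const

end PartialDerivatives

/-- `G` is a smooth pseudo-Riemannian metric on the open set `U`, given by its components. -/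
structure IsMetricOn (G : Coord n → Matrix (Fin n) (Fin n) ℝ) (U : Set (Coord n)) : Prop where
  isOpen : IsOpen U
  smooth : ∀ a b, ContDiffOn ℝ ∞ (fun x => G x a b) U
  symm : ∀ x ∈ U, (G x).IsSymm
  det_ne_zero : ∀ x ∈ U, (G x).det ≠ 0

lemma contDiffOn_det {ι : Type*} [Fintype ι] [DecidableEq ι] {A : Coord n → Matrix ι ι ℝ}
    {U : Set (Coord n)} (hA : ∀ a b, ContDiffOn ℝ ∞ (fun x => A x a b) U) :
    ContDiffOn ℝ ∞ (fun x => (A x).det) U := by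
  simp only [Matrix.det_apply']
  exact ContDiffOn.sum fun σ _ => contDiffOn_const.mul (contDiffOn_prod fun i _ => hA _ _)

namespace IsMetricOn

open scoped Topology

variable {G : Coord n → Matrix (Fin n) (Fin n) ℝ} {U : Set (Coord n)} {x : Coord n}

lemma inv_mul (H : IsMetricOn G U) (hx : x ∈ U) : (G x)⁻¹ * G x = 1 :=
  Matrix.nonsing_inv_mul _ (H.det_ne_zero x hx).isUnit

lemma mul_inv (H : IsMetricOn G U) (hx : x ∈ U) : G x * (G x)⁻¹ = 1 :=
  Matrix.mul_nonsing_inv _ (H.det_ne_zero x hx).isUnit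

lemma symm_inv (H : IsMetricOn G U) (hx : x ∈ U) : (G x)⁻¹.IsSymm := by
  unfold Matrix.IsSymm
  rw [Matrix.transpose_nonsing_inv, (H.symm x hx).eq]

lemma eventually (H : IsMetricOn G U) (hx : x ∈ U) {f f' : Coord n → ℝ}
    (h : ∀ y ∈ U, f y = f' y) : f =ᶠ[𝓝 x] f' :=
  Filter.eventually_of_mem (H.isOpen.mem_nhds hx) h

lemma differentiableAt (H : IsMetricOn G U) (hx : x ∈ U) {f : Coord n → ℝ}
    (hf : ContDiffOn ℝ ∞ f U) : DifferentiableAt ℝ f x :=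
  (hf.contDiffAt (H.isOpen.mem_nhds hx)).differentiableAt (by simp)

lemma smooth_inv (H : IsMetricOn G U) (a b : Fin n) :
    ContDiffOn ℝ ∞ (fun x => (G x)⁻¹ a b) U := by
  simp only [Matrix.inv_def, Ring.inverse_eq_inv', Matrix.smul_apply, smul_eq_mul,
    Matrix.adjugate_apply]
  refine ((contDiffOn_det H.smooth).inv H.det_ne_zero).mul (contDiffOn_det fun c d => ?_)
  by_cases h : c = b
  · simp only [Matrix.updateRow_apply, h, if_true]
    exact contDiffOn_const
  · simp only [Matrix.updateRow_apply, h, if_false]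
    exact H.smooth c d

lemma smooth_christoffel (H : IsMetricOn G U) (c a b : Fin n) :
    ContDiffOn ℝ ∞ (christoffel G c a b) U := by
  unfold christoffel
  exact contDiffOn_const.mul (ContDiffOn.sum fun d _ => (H.smooth_inv c d).mul
    (((contDiffOn_pd H.isOpen (H.smooth d b) a).add (contDiffOn_pd H.isOpen (H.smooth d a) b)).sub
      (contDiffOn_pd H.isOpen (H.smooth a b) d)))

lemma smooth_riemannUp (H : IsMetricOn G U) (a b c d : Fin n) :
    ContDiffOn ℝ ∞ (riemannUp G a b c d) U := by
  unfold riemannUp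
  exact ((contDiffOn_pd H.isOpen (H.smooth_christoffel _ _ _) c).sub
    (contDiffOn_pd H.isOpen (H.smooth_christoffel _ _ _) d)).add (ContDiffOn.sum fun e _ =>
      ((H.smooth_christoffel _ _ _).mul (H.smooth_christoffel _ _ _)).sub
      ((H.smooth_christoffel _ _ _).mul (H.smooth_christoffel _ _ _)))

lemma smooth_ricci (H : IsMetricOn G U) (a b : Fin n) : ContDiffOn ℝ ∞ (ricci G a b) U := by
  unfold ricci
  exact ContDiffOn.sum fun c _ => H.smooth_riemannUp _ _ _ _

lemma pd_symm (H : IsMetricOn G U) (hx : x ∈ U) (a b c : Fin n) :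
    pd c (fun y => G y b a) x = pd c (fun y => G y a b) x :=
  pd_congr (H.eventually hx fun y hy => (H.symm y hy).apply a b) c

lemma christoffel_symm (H : IsMetricOn G U) (hx : x ∈ U) (c a b : Fin n) :
    christoffel G c b a x = christoffel G c a b x := by
  unfold christoffel
  congr 1
  refine Finset.sum_congr rfl fun d _ => ?_
  rw [H.pd_symm hx a b d]
  ring

/-- The Christoffel symbols of the first kind. -/
lemma lower_christoffel (H : IsMetricOn G U) (hx : x ∈ U) (a b c : Fin n) :
    ∑ e, G x a e * christoffel G e b c x
      = 1 / 2 * (pd b (fun y => G y a c) x + pd c (fun y => G y a b) x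
        - pd a (fun y => G y b c) x) := by
  set v : Fin n → ℝ := fun d => 1 / 2 * (pd b (fun y => G y d c) x + pd c (fun y => G y d b) x
        - pd d (fun y => G y b c) x) with hv
  have h1 : (fun e => christoffel G e b c x) = (G x)⁻¹.mulVec v := by
    ext e
    simp only [christoffel, Matrix.mulVec, dotProduct, Finset.mul_sum, hv]
    exact Finset.sum_congr rfl fun d _ => by ring
  have h2 : (G x).mulVec (fun e => christoffel G e b c x) = v := by
    rw [h1, Matrix.mulVec_mulVec, H.mul_inv hx, Matrix.one_mulVec]
  exact congrFun h2 a

/-- The metric is parallel. -/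
lemma pd_metric (H : IsMetricOn G U) (hx : x ∈ U) (a b c : Fin n) :
    pd c (fun y => G y a b) x = ∑ e, G x a e * christoffel G e c b x
      + ∑ e, G x b e * christoffel G e c a x := by
  rw [H.lower_christoffel hx, H.lower_christoffel hx, H.pd_symm hx a b, H.pd_symm hx c a,
    H.pd_symm hx c b]
  ring

/-- `R_{abcd}` in terms of the Christoffel symbols of the first kind, using that the metric is
parallel to move it past a derivative. -/
lemma riemann_eq (H : IsMetricOn G U) (hx : x ∈ U) (a b c d : Fin n) :
    riemann G a b c d x = pd c (fun y => ∑ e, G y a e * christoffel G e d b y) x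
      - pd d (fun y => ∑ e, G y a e * christoffel G e c b y) x
      - ∑ e, ∑ f, G x e f * christoffel G f c a x * christoffel G e d b x
      + ∑ e, ∑ f, G x e f * christoffel G f d a x * christoffel G e c b x := by
  have hpd : ∀ c d, pd c (fun y => ∑ e, G y a e * christoffel G e d b y) x
      = ∑ e, G x a e * pd c (christoffel G e d b) x
        + ∑ e, ∑ f, G x a f * christoffel G f c e x * christoffel G e d b x
        + ∑ e, ∑ f, G x e f * christoffel G f c a x * christoffel G e d b x := by
    intro c d
    rw [pd_sum (F := fun e y => G y a e * christoffel G e d b y) fun e _ =>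
      (H.differentiableAt hx (H.smooth a e)).mul
      (H.differentiableAt hx (H.smooth_christoffel e d b))]
    simp only [← Finset.sum_add_distrib]
    refine Finset.sum_congr rfl fun e _ => ?_
    rw [pd_mul (H.differentiableAt hx (H.smooth a e))
      (H.differentiableAt hx (H.smooth_christoffel e d b)), H.pd_metric hx]
    simp only [add_mul, Finset.sum_mul]
    ring
  have hR : riemann G a b c d x = ∑ e, G x a e * pd c (christoffel G e d b) x
      - ∑ e, G x a e * pd d (christoffel G e c b) x
      + ∑ e, ∑ f, G x a f * christoffel G f c e x * christoffel G e d b x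
      - ∑ e, ∑ f, G x a f * christoffel G f d e x * christoffel G e c b x := by
    have e1 : ∀ c d, ∑ e, ∑ f, G x a f * christoffel G f c e x * christoffel G e d b x
        = ∑ e, G x a e * ∑ f, christoffel G e c f x * christoffel G f d b x := by
      intro c d
      rw [Finset.sum_comm]
      simp only [Finset.mul_sum, mul_assoc]
    rw [e1, e1]
    simp only [riemann, riemannUp, mul_add, mul_sub, Finset.sum_add_distrib,
      Finset.sum_sub_distrib]
    ring
  rw [hR, hpd, hpd]
  ring

/-- The antisymmetry `R_{bacd} = -R_{abcd}`: the Ricci identity for the parallel tensor `g`. -/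
lemma riemann_anti_left (H : IsMetricOn G U) (hx : x ∈ U) (a b c d : Fin n) :
    riemann G b a c d x = -riemann G a b c d x := by
  have dif : ∀ a b c, DifferentiableAt ℝ (fun y => ∑ e, G y a e * christoffel G e b c y) x :=
    fun a b c => H.differentiableAt hx
      (ContDiffOn.sum fun e _ => (H.smooth a e).mul (H.smooth_christoffel e b c))
  have key : ∀ c d, pd c (fun y => ∑ e, G y a e * christoffel G e d b y) x
      + pd c (fun y => ∑ e, G y b e * christoffel G e d a y) x
      = pd c (pd d fun y => G y a b) x := by
    intro c d
    rw [← pd_add (dif a d b) (dif b d a)]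
    exact pd_congr (H.eventually hx fun y hy => (H.pd_metric hy a b d).symm) c
  have sw : ∀ a b c d, ∑ e, ∑ f, G x e f * christoffel G f c a x * christoffel G e d b x
      = ∑ e, ∑ f, G x e f * christoffel G f d b x * christoffel G e c a x := by
    intro a b c d
    rw [Finset.sum_comm]
    refine Finset.sum_congr rfl fun e _ => Finset.sum_congr rfl fun f _ => ?_
    rw [(H.symm x hx).apply]; ring
  have hc := pd_comm (((H.smooth a b).contDiffAt (H.isOpen.mem_nhds hx)).of_le
    ENat.LEInfty.out) c d
  rw [H.riemann_eq hx, H.riemann_eq hx, sw a b c d, sw a b d c]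
  linarith [key c d, key d c]

lemma isCurvatureLike_riemann (H : IsMetricOn G U) (hx : x ∈ U) :
    IsCurvatureLike fun a b c d => riemann G a b c d x where
  anti_left := H.riemann_anti_left hx
  anti_right a b c d := by
    simp only [riemann, ← Finset.sum_neg_distrib]
    refine Finset.sum_congr rfl fun e _ => ?_
    simp only [riemannUp, Finset.sum_sub_distrib]
    ring
  cyclic a b c d := by
    simp only [riemann, ← Finset.sum_add_distrib, ← mul_add]
    refine Finset.sum_eq_zero fun e _ => ?_
    have s : ∀ a b c f, pd f (christoffel G a b c) x = pd f (christoffel G a c b) x :=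
      fun a b c f => pd_congr (H.eventually hx fun y hy => H.christoffel_symm hy a c b) f
    have s' : ∀ a b c, christoffel G a b c x = christoffel G a c b x :=
      fun a b c => H.christoffel_symm hx a c b
    simp only [riemannUp, Finset.sum_sub_distrib]
    rw [s e d b, s e c b, s e d c]
    simp only [s' _ d b, s' _ c b, s' _ d c]
    ring

lemma contr_riemann (H : IsMetricOn G U) (hx : x ∈ U) (b d : Fin n) :
    contr (G x)⁻¹ (fun a c => riemann G a b c d x) = ricci G b d x := by
  rw [← contr_swap (H.symm_inv hx)]
  have : ∀ c, ∑ a, (G x)⁻¹ c a * riemann G a b c d x = riemannUp G c b c d x := by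
    intro c
    have h2 : (G x)⁻¹.mulVec ((G x).mulVec fun e => riemannUp G e b c d x)
        = fun e => riemannUp G e b c d x := by
      rw [Matrix.mulVec_mulVec, H.inv_mul hx, Matrix.one_mulVec]
    exact congrFun h2 c
  simp only [contr, this, ricci]

section Box

variable {S : Fin n → Fin n → Coord n → ℝ}

lemma covDeriv2_metric (H : IsMetricOn G U) (hx : x ∈ U) (c a b : Fin n) :
    covDeriv2 G (fun a b y => G y a b) c a b x = 0 := by
  unfold covDeriv2
  rw [H.pd_metric hx]
  have e1 : ∑ d, christoffel G d c a x * G x d b = ∑ e, G x b e * christoffel G e c a x :=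
    Finset.sum_congr rfl fun e _ => by rw [(H.symm x hx).apply]; ring
  have e2 : ∑ d, christoffel G d c b x * G x a d = ∑ e, G x a e * christoffel G e c b x :=
    Finset.sum_congr rfl fun e _ => by ring
  rw [e1, e2]
  ring

/-- Adding a constant multiple of the metric does not change the first covariant derivative. -/
lemma covDeriv2_add_metric (H : IsMetricOn G U) (hx : x ∈ U)
    {T : Fin n → Fin n → Coord n → ℝ} {r : ℝ} (hS : ∀ a b, DifferentiableAt ℝ (S a b) x)
    (hT : ∀ y ∈ U, ∀ a b, T a b y = S a b y + r * G y a b) (c a b : Fin n) :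
    covDeriv2 G T c a b x = covDeriv2 G S c a b x := by
  have h0 := H.covDeriv2_metric hx c a b
  unfold covDeriv2 at h0 ⊢
  have hG := H.differentiableAt hx (H.smooth a b)
  rw [pd_congr (H.eventually hx fun y hy => hT y hy a b) c, pd_add (hS a b) (hG.const_mul r),
    pd_const_mul hG]
  simp only [hT x hx, mul_add, Finset.sum_add_distrib, mul_left_comm _ r, ← Finset.mul_sum]
  linear_combination r * h0

lemma boxTensor_add_metric (H : IsMetricOn G U) (hx : x ∈ U)
    {T : Fin n → Fin n → Coord n → ℝ} {r : ℝ}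
    (hS : ∀ y ∈ U, ∀ a b, DifferentiableAt ℝ (S a b) y)
    (hT : ∀ y ∈ U, ∀ a b, T a b y = S a b y + r * G y a b) (a b : Fin n) :
    boxTensor G T a b x = boxTensor G S a b x := by
  have h : ∀ y ∈ U, ∀ c a b, covDeriv2 G T c a b y = covDeriv2 G S c a b y :=
    fun y hy c a b => H.covDeriv2_add_metric hy (hS y hy) hT c a b
  unfold boxTensor covDeriv3
  simp only [h x hx]
  refine Finset.sum_congr rfl fun d _ => Finset.sum_congr rfl fun c _ => ?_
  rw [pd_congr (H.eventually hx fun y hy => h y hy c a b) d]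

lemma hess_of_const (H : IsMetricOn G U) (hx : x ∈ U) {f : Coord n → ℝ} {r : ℝ}
    (hf : ∀ y ∈ U, f y = r) (a b : Fin n) : hess G f a b x = 0 := by
  have h1 : ∀ y ∈ U, ∀ c, pd c f y = 0 := fun y hy c => by
    rw [pd_congr (H.eventually hy hf) c, pd_const]
  unfold hess
  rw [pd_congr (H.eventually hx fun y hy => h1 y hy b) a, pd_const]
  simp [h1 x hx]

end Box

end IsMetricOn

/-! ### Coordinate components of a Lorentzian metric -/

lemma mdifferentiable_of_mem_maximalAtlas {n : ℕ} {M : Type*} [TopologicalSpace M]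
    [ChartedSpace (EuclideanSpace ℝ (Fin n)) M]
    {e : OpenPartialHomeomorph M (EuclideanSpace ℝ (Fin n))}
    (he : e ∈ IsManifold.maximalAtlas (𝓡 n) ∞ M) :
    e.MDifferentiable (𝓡 n) (𝓡 n) :=
  ⟨(contMDiffOn_of_mem_maximalAtlas he).mdifferentiableOn (by simp),
    (contMDiffOn_symm_of_mem_maximalAtlas he).mdifferentiableOn (by simp)⟩

lemma sum_smul_coordVector {n : ℕ} {M : Type*} [TopologicalSpace M]
    [ChartedSpace (EuclideanSpace ℝ (Fin n)) M]
    (e : OpenPartialHomeomorph M (EuclideanSpace ℝ (Fin n)))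
    (x : Coord n) (w : Coord n) :
    ∑ a, w a • coordVector e a x = mfderiv (𝓡 n) (𝓡 n) e.symm x w := by
  have hw : (w : Coord n) = ∑ a, w a • (EuclideanSpace.single a (1 : ℝ) : Coord n) := by
    ext b
    simp [Pi.single_apply]
  conv_rhs => rw [hw]
  unfold coordVector
  let D : Coord n →L[ℝ] TangentSpace (𝓡 n) (e.symm x) := mfderiv (𝓡 n) (𝓡 n) e.symm x
  change _ = D _
  rw [map_sum]
  exact Finset.sum_congr rfl fun a _ => (D.map_smul _ _).symm

lemma sum_upComp_smul_coordVector {n : ℕ} {M : Type*} [TopologicalSpace M]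
    [ChartedSpace (EuclideanSpace ℝ (Fin n)) M]
    {e : OpenPartialHomeomorph M (EuclideanSpace ℝ (Fin n))} {x : Coord n}
    (he : e ∈ IsManifold.maximalAtlas (𝓡 n) ∞ M)
    (hx : x ∈ e.target) (ℓ : ∀ p : M, TangentSpace (𝓡 n) p) :
    ∑ a, upComp e ℓ x a • coordVector e a x = ℓ (e.symm x) := by
  have h := (mdifferentiable_of_mem_maximalAtlas he).symm_comp_deriv (e.map_target hx)
  rw [e.right_inv hx] at h
  exact (sum_smul_coordVector e x _).trans (DFunLike.congr_fun h (ℓ (e.symm x)))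

section Spacetime

variable {n : ℕ} {M : Type*} [TopologicalSpace M]
  [ChartedSpace (EuclideanSpace ℝ (Fin n)) M] [IsManifold (𝓡 n) ∞ M]

variable {e : OpenPartialHomeomorph M (EuclideanSpace ℝ (Fin n))} {x : Coord n}

lemma LorentzianMetric.inner_sum_sum (g : LorentzianMetric n M)
    (e : OpenPartialHomeomorph M (EuclideanSpace ℝ (Fin n))) (x : Coord n) (u v : Fin n → ℝ) :
    g.inner (e.symm x) (∑ a, u a • coordVector e a x) (∑ b, v b • coordVector e b x)
      = sp (g.coord e x) u v := by
  simp only [map_sum, _root_.sum_apply, map_smul, _root_.smul_apply,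
    smul_eq_mul, sp, LorentzianMetric.coord, Matrix.of_apply]
  simp only [Finset.mul_sum]
  rw [Finset.sum_comm]
  exact Finset.sum_congr rfl fun a _ => Finset.sum_congr rfl fun b _ => by ring

lemma LorentzianMetric.sp_upComp (g : LorentzianMetric n M)
    (he : e ∈ IsManifold.maximalAtlas (𝓡 n) ∞ M)
    (hx : x ∈ e.target) (ℓ : ∀ p : M, TangentSpace (𝓡 n) p) :
    sp (g.coord e x) (upComp e ℓ x) (upComp e ℓ x)
      = g.inner (e.symm x) (ℓ (e.symm x)) (ℓ (e.symm x)) := by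
  rw [← g.inner_sum_sum, sum_upComp_smul_coordVector he hx]

lemma LorentzianMetric.eq_zero_of_inner (g : LorentzianMetric n M) {p : M}
    {v : TangentSpace (𝓡 n) p} (h : ∀ w, g.inner p w v = 0) : v = 0 := by
  obtain ⟨b, hb⟩ := g.signature p
  rw [← b.forall_coord_eq_zero_iff]
  intro i
  have := h (b i)
  rw [← b.sum_repr v] at this
  simp only [map_sum, map_smul, hb, smul_eq_mul, mul_ite, mul_zero, Finset.sum_ite_eq,
    Finset.mem_univ, if_true] at this
  rw [Module.Basis.coord_apply]
  split_ifs at this <;> linarith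

lemma LorentzianMetric.det_coord_ne_zero (g : LorentzianMetric n M)
    (he : e ∈ IsManifold.maximalAtlas (𝓡 n) ∞ M) (hx : x ∈ e.target) :
    (g.coord e x).det ≠ 0 := by
  intro h0
  obtain ⟨v, hv, hGv⟩ := Matrix.exists_mulVec_eq_zero_iff.2 h0
  have hD := mdifferentiable_of_mem_maximalAtlas he
  have hzero : ∑ a, v a • coordVector e a x = 0 := by
    refine g.eq_zero_of_inner fun w => ?_
    obtain ⟨u, hu⟩ : ∃ u : Fin n → ℝ, ∑ a, u a • coordVector e a x = w := by
      have h := hD.symm_comp_deriv (e.map_target hx)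
      rw [e.right_inv hx] at h
      let w' : Coord n := mfderiv (𝓡 n) (𝓡 n) e (e.symm x) w
      exact ⟨w', (sum_smul_coordVector e x w').trans (DFunLike.congr_fun h w)⟩
    rw [← hu, g.inner_sum_sum]
    unfold sp
    refine Finset.sum_eq_zero fun a _ => ?_
    have := congrFun hGv a
    simp only [Matrix.mulVec, dotProduct, Pi.zero_apply] at this
    calc _ = u a * ∑ b, g.coord e x a b * v b := by
          rw [Finset.mul_sum]; exact Finset.sum_congr rfl fun b _ => by ring
      _ = 0 := by rw [this, mul_zero]
  apply hv
  have hinj := hD.symm.mfderiv_injective (x := x) hx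
  have h1 := sum_smul_coordVector e x (WithLp.toLp 2 v)
  have h2 : (WithLp.toLp 2 v : Coord n) = 0 := by
    apply hinj
    exact (h1.symm.trans hzero).trans (ContinuousLinearMap.map_zero _).symm
  ext a
  exact congrArg (fun w : Coord n => w a) h2

lemma LorentzianMetric.contDiffOn_coord (g : LorentzianMetric n M)
    (he : e ∈ IsManifold.maximalAtlas (𝓡 n) ∞ M) (a b : Fin n) :
    ContDiffOn ℝ ∞ (fun x => g.coord e x a b) e.target := by
  have hsymm := contMDiffOn_symm_of_mem_maximalAtlas he
  have hu : UniqueMDiffOn (𝓡 n) e.target := e.open_target.uniqueMDiffOn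
  have hv : ∀ a, ContMDiffOn (𝓡 n) ((𝓡 n).prod 𝓘(ℝ, Coord n)) ∞
      (fun x => Bundle.TotalSpace.mk' (Coord n) (E := fun p : M => TangentSpace (𝓡 n) p)
        (e.symm x) (coordVector e a x)) e.target := by
    intro a
    have h1 := hsymm.contMDiffOn_tangentMapWithin (m := ∞) (by simp) hu
    have h2 : ContMDiffOn (𝓡 n) ((𝓡 n).prod 𝓘(ℝ, Coord n)) ∞
        (fun x : Coord n => (⟨x, EuclideanSpace.single a (1 : ℝ)⟩ :
          TangentBundle (𝓡 n) (Coord n))) e.target :=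
      contMDiffOn_vectorSpace_iff_contDiffOn.2 contDiffOn_const
    refine (h1.comp h2 fun x hx => hx).congr fun x hx => ?_
    simp only [Function.comp, tangentMapWithin]
    rw [mfderivWithin_of_isOpen e.open_target hx]
    rfl
  have h := ContMDiffOn.clm_bundle_apply₂ (F₁ := Coord n) (F₂ := Coord n) (F₃ := ℝ)
    (E₃ := Bundle.Trivial M ℝ) (b := e.symm) (ψ := fun x => g.inner (e.symm x))
    (g.contMDiff.comp_contMDiffOn hsymm) (hv a) (hv b)
  rw [← contMDiffOn_iff_contDiffOn]
  intro x hx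
  have := h x hx
  simp only [Bundle.contMDiffWithinAt_totalSpace] at this
  exact this.2

lemma LorentzianMetric.isMetricOn_coord (g : LorentzianMetric n M)
    (he : e ∈ IsManifold.maximalAtlas (𝓡 n) ∞ M) : IsMetricOn (g.coord e) e.target where
  isOpen := e.open_target
  smooth := g.contDiffOn_coord he
  symm x _ := by ext a b; exact g.symm _ _ _
  det_ne_zero _ hx := g.det_coord_ne_zero he hx

end Spacetime

/-! ### The field equations -/

section CurvatureContractions

variable (G : Coord n → Matrix (Fin n) (Fin n) ℝ) (a b : Fin n) (x : Coord n)

lemma riemannRicci_eq_contr : riemannRicci G a b x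
    = contr (G x)⁻¹ fun c c' => contr (G x)⁻¹ fun d d' => riemann G a c b d x * ricci G c' d' x := by
  simp only [riemannRicci, ricciUpUp, contr, Finset.mul_sum]
  refine Finset.sum_congr rfl fun c _ => ?_
  rw [Finset.sum_comm]
  refine Finset.sum_congr rfl fun c' _ => Finset.sum_congr rfl fun d _ =>
    Finset.sum_congr rfl fun d' _ => by ring

lemma ricciRicci_eq_contr : ricciRicci G a b x
    = contr (G x)⁻¹ fun c d => ricci G a c x * ricci G b d x := by
  simp only [ricciRicci, contr, mul_assoc]

lemma ricciSq_eq_contr : ricciSq G x = contr (G x)⁻¹ fun a b => ricciRicci G a b x := by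
  simp only [ricciSq, ricciUpUp, ricciRicci, contr, Finset.mul_sum]
  calc _ = ∑ c, ∑ c', ∑ d, ∑ d', ricci G c d x * ((G x)⁻¹ c c' * (G x)⁻¹ d d' * ricci G c' d' x) :=
        Finset.sum_congr rfl fun c _ => Finset.sum_comm
    _ = _ := Finset.sum_congr rfl fun c _ => Finset.sum_congr rfl fun c' _ =>
        Finset.sum_congr rfl fun d _ => Finset.sum_congr rfl fun d' _ => by ring

lemma riemannRiemann_eq_contr : riemannRiemann G a b x
    = contr3 (G x)⁻¹ (fun a b c d => riemann G a b c d x) (fun a b c d => riemann G a b c d x)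
      a b := by
  simp only [riemannRiemann, contr3, contr, Finset.mul_sum]
  refine Finset.sum_congr rfl fun c _ => ?_
  have push : ∀ f : Fin n → Fin n → Fin n → Fin n → Fin n → ℝ,
      ∑ d, ∑ e, ∑ c', ∑ d', ∑ e', f d e c' d' e' = ∑ c', ∑ d, ∑ d', ∑ e, ∑ e', f d e c' d' e' := by
    intro f
    calc _ = ∑ d, ∑ c', ∑ e, ∑ d', ∑ e', f d e c' d' e' :=
          Finset.sum_congr rfl fun d _ => Finset.sum_comm
      _ = ∑ c', ∑ d, ∑ e, ∑ d', ∑ e', f d e c' d' e' := Finset.sum_comm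
      _ = _ := Finset.sum_congr rfl fun c' _ => Finset.sum_congr rfl fun d _ => Finset.sum_comm
  rw [push]
  refine Finset.sum_congr rfl fun c' _ => Finset.sum_congr rfl fun d _ =>
    Finset.sum_congr rfl fun d' _ => Finset.sum_congr rfl fun e _ =>
    Finset.sum_congr rfl fun e' _ => by ring

lemma riemannSq_eq_contr :
    riemannSq G x = contr (G x)⁻¹ fun a b => riemannRiemann G a b x := rfl

lemma scalarCurv_eq_contr : scalarCurv G x = contr (G x)⁻¹ fun a b => ricci G a b x := rfl

end CurvatureContractions

section FieldEquations

variable {G : Coord n → Matrix (Fin n) (Fin n) ℝ} {U : Set (Coord n)} {x : Coord n}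

lemma weyl_eq_sub_kulkarni (hn : 4 ≤ n) (hg : (G x).IsSymm) {lam : ℝ} {S : Fin n → Fin n → ℝ}
    (hS : ∀ a b, S a b = S b a) (hric : ∀ a b, ricci G a b x = lam * G x a b + S a b)
    (hR : scalarCurv G x = n * lam) (a b c d : Fin n) :
    weyl G a b c d x = riemann G a b c d x - kulkarni (G x) (schouten (G x) lam S) a b c d := by
  have h4 : (4 : ℝ) ≤ n := by exact_mod_cast hn
  have hn1 : (n : ℝ) - 1 ≠ 0 := by intro h0; linarith
  have hn2 : (n : ℝ) - 2 ≠ 0 := by intro h0; linarith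
  simp only [weyl, kulkarni, schouten, hric, hR]
  rw [hS d b, hS c b, hS d a, hS c a, hg.apply b d, hg.apply b c, hg.apply a d, hg.apply a c]
  field_simp
  ring

/-- The field equations on a coordinate domain `U`: for a metric with Ricci tensor `λ g + S`,
`S = φ ℓ ℓ`, the left-hand side equals `-2 𝓑 g + (β □ + 𝓐) S`. -/
theorem fieldTensor_eq_zero (hn : 4 ≤ n) (P : Couplings) (Λ : ℝ)
    (H : IsMetricOn G U) {S : Fin n → Fin n → Coord n → ℝ} {φ : Coord n → ℝ}
    {ℓ : Coord n → Fin n → ℝ}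
    (hS : ∀ x ∈ U, ∀ a b, S a b x = φ x * (∑ c, G x a c * ℓ x c) * ∑ c, G x b c * ℓ x c)
    (hℓ : ∀ x ∈ U, sp (G x) (ℓ x) (ℓ x) = 0)
    (hric : ∀ x ∈ U, ∀ a b, ricci G a b x = 2 * Λ / ((n : ℝ) - 2) * G x a b + S a b x)
    (hW : ∀ x ∈ U, WeylTypeIIIB (G x) (fun a b c d => weyl G a b c d x) (ℓ x) ∨
      WeylTypeN (G x) (fun a b c d => weyl G a b c d x) (ℓ x) ∨
      WeylTypeO (fun a b c d => weyl G a b c d x))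
    (hB : P.constB n Λ = 0)
    (hA : ∀ x ∈ U, ∀ a b, P.β * boxTensor G S a b x + P.constA n Λ * S a b x = 0)
    (hx : x ∈ U) (a b : Fin n) : fieldTensor P G a b x = 0 := by
  have h4 : (4 : ℝ) ≤ n := by exact_mod_cast hn
  have hn1 : (n : ℝ) - 1 ≠ 0 := by intro h0; linarith
  have hn2 : (n : ℝ) - 2 ≠ 0 := by intro h0; linarith
  set lam : ℝ := 2 * Λ / ((n : ℝ) - 2) with hlam
  have hSsymm : ∀ x ∈ U, ∀ a b, S a b x = S b a x := fun x hx a b => by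
    rw [hS x hx, hS x hx]; ring
  have hStr : ∀ x ∈ U, contr (G x)⁻¹ (fun a b => S a b x) = 0 := fun x hx =>
    contr_null (H.inv_mul hx) (hS x hx) (hℓ x hx)
  have htr : ∀ x ∈ U, ∀ r s : ℝ, contr (G x)⁻¹ (fun a b => r * G x a b + s * S a b x) = n * r := by
    intro x hx r s
    have e : contr (G x)⁻¹ (fun a b => r * G x a b) = r * n := by
      rw [← contr_metric (H.symm x hx) (H.inv_mul hx)]; exact contr_const_mul _ _ (G x)
    rw [contr_add, e, contr_const_mul, hStr x hx]
    ring
  have hR : ∀ x ∈ U, scalarCurv G x = n * lam := by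
    intro x hx
    rw [scalarCurv_eq_contr, ← htr x hx lam 1]
    simp only [hric x hx, one_mul]
  -- `Φ` and `ℓ` are not assumed differentiable; `S` is, being `R_{ab} - λ g_{ab}`
  have hSdiff : ∀ y ∈ U, ∀ a b, DifferentiableAt ℝ (S a b) y := by
    intro y hy a b
    have h1 : DifferentiableAt ℝ (fun z => ricci G a b z - lam * G z a b) y :=
      (H.differentiableAt hy (H.smooth_ricci a b)).sub
        ((H.differentiableAt hy (H.smooth a b)).const_mul lam)
    refine h1.congr_of_eventuallyEq (H.eventually hy fun z hz => ?_)
    rw [hric z hz]; ring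
  have hbox : boxTensor G (fun c d y => ricci G c d y - 1 / 2 * scalarCurv G y * G y c d) a b x
      = boxTensor G S a b x := by
    refine H.boxTensor_add_metric hx (r := lam - 1 / 2 * (n * lam)) hSdiff (fun y hy a b => ?_) a b
    rw [hric y hy, hR y hy]; ring
  have hhess : ∀ a b, hess G (scalarCurv G) a b x = 0 := H.hess_of_const hx hR
  have hboxR : boxScalar G (scalarCurv G) x = 0 := by simp [boxScalar, hhess]
  have hweyl := weyl_eq_sub_kulkarni hn (H.symm x hx) (hSsymm x hx) (hric x hx) (hR x hx)
  have hPs : ∀ a b, schouten (G x) lam (fun a b => S a b x) a b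
      = schouten (G x) lam (fun a b => S a b x) b a :=
    schouten_comm (H.symm x hx) (hSsymm x hx)
  have hCc : IsCurvatureLike fun a b c d => weyl G a b c d x := by
    simp only [hweyl]
    exact (H.isCurvatureLike_riemann hx).sub (isCurvatureLike_kulkarni (H.symm x hx) hPs)
  have hCtr : ∀ b d, contr (G x)⁻¹ (fun a c => weyl G a b c d x) = 0 := by
    intro b d
    have trP : contr (G x)⁻¹ (schouten (G x) lam fun a b => S a b x)
        = n * (lam / (2 * (n - 1))) := htr x hx _ _
    simp only [hweyl, contr_sub]
    rw [H.contr_riemann hx, contr_kulkarni (H.symm x hx) (H.symm_inv hx) (H.inv_mul hx) hPs, trP,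
      hric x hx]
    unfold schouten
    field_simp
    ring
  have hWx := fun a b => contr_eq_zero_of_weylType (by omega) (H.symm x hx) (H.inv_mul hx) hCc hCtr
    (hW x hx) a b
  have K : IsNullRadiationCurvature (G x) (G x)⁻¹ (ℓ x) lam (φ x) (fun a b => S a b x)
      (fun a b c d => riemann G a b c d x) (fun a b c d => weyl G a b c d x) :=
    { symm_g := H.symm x hx
      symm_h := H.symm_inv hx
      inv := H.inv_mul hx
      curv := H.isCurvatureLike_riemann hx
      S_eq := hS x hx
      null := hℓ x hx
      ric := fun b d => by rw [H.contr_riemann hx, hric x hx]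
      decomp := fun a b c d => by rw [hweyl]; ring
      weyl_curv := hCc
      weyl_trace := hCtr
      weyl_ℓ := fun a b => (hWx a b).2
      weyl_weyl := fun a b => (hWx a b).1 }
  have hRR : ∀ a b, riemannRicci G a b x
      = lam * (lam * G x a b + S a b x) - lam / (n - 1) * S a b x := fun a b => by
    rw [riemannRicci_eq_contr]
    simp only [hric x hx]
    exact K.riemann_ricci hn a b
  have hRmRm : ∀ a b, riemannRiemann G a b x
      = 2 * lam ^ 2 / (n - 1) * G x a b + 4 * lam / (n - 1) * S a b x := fun a b => by
    rw [riemannRiemann_eq_contr]; exact K.riemann_riemann hn a b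
  have hRcRc : ∀ a b, ricciRicci G a b x = lam ^ 2 * G x a b + 2 * lam * S a b x := fun a b => by
    rw [ricciRicci_eq_contr]
    simp only [hric x hx]
    exact K.ricci_ricci a b
  have hRcSq : ricciSq G x = n * lam ^ 2 := by
    rw [ricciSq_eq_contr]
    simp only [hRcRc]
    exact htr x hx _ _
  have hRmSq : riemannSq G x = n * (2 * lam ^ 2 / (n - 1)) := by
    rw [riemannSq_eq_contr]
    simp only [hRmRm]
    exact htr x hx _ _
  have hAx := hA x hx a b
  unfold fieldTensor
  rw [hbox, hhess, hboxR, hRR, hRmRm, hRcRc, hRcSq, hRmSq, hR x hx, hric x hx]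
  have key : 1 / P.κ * (lam * G x a b + S a b x - 1 / 2 * (n * lam) * G x a b + P.Λ₀ * G x a b)
      + 2 * P.α * (n * lam) * (lam * G x a b + S a b x - 1 / 4 * (n * lam) * G x a b)
      + 2 * P.γ * (n * lam * (lam * G x a b + S a b x)
        - 2 * (lam * (lam * G x a b + S a b x) - lam / (n - 1) * S a b x)
        + (2 * lam ^ 2 / (n - 1) * G x a b + 4 * lam / (n - 1) * S a b x)
        - 2 * (lam ^ 2 * G x a b + 2 * lam * S a b x)
        - 1 / 4 * G x a b * (n * (2 * lam ^ 2 / (n - 1)) - 4 * (n * lam ^ 2) + (n * lam) ^ 2))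
      + 2 * P.β * (lam * (lam * G x a b + S a b x) - lam / (n - 1) * S a b x
        - 1 / 4 * G x a b * (n * lam ^ 2))
      = -2 * P.constB n Λ * G x a b + P.constA n Λ * S a b x := by
    simp only [Couplings.constB, Couplings.constA, Couplings.eps, hlam, div_eq_mul_inv,
      mul_inv]
    generalize P.κ⁻¹ = k
    field_simp
    ring
  rw [hB] at key
  linear_combination key + hAx

end FieldEquations

end QuadGrav

end

theorem mainTheorem7 {n : ℕ} (hn : 4 ≤ n) {M : Type*} [TopologicalSpace M]
    [ChartedSpace (EuclideanSpace ℝ (Fin n)) M] [IsManifold (𝓡 n) ∞ M]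
    (g : QuadGrav.LorentzianMetric n M) (P : QuadGrav.Couplings) (hκ : P.κ ≠ 0) (Λ : ℝ)
    (Φ : M → ℝ) (ℓ : ∀ p : M, TangentSpace (𝓡 n) p)
    (hℓ : g.IsNullField ℓ)
    (hWeyl : g.HasWeylTypeIIIBorNorO ℓ)
    (hRicci : g.HasNullRadiationRicci Λ Φ ℓ)
    (hB : P.constB n Λ = 0)
    (hA : g.NullRadiationEquation P.β (P.constA n Λ) Φ ℓ) :
    g.SolvesVacuumQuadraticGravity P := by
  intro e he x hx a b
  exact QuadGrav.fieldTensor_eq_zero hn P Λ (g.isMetricOn_coord he)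
    (S := g.nullRadiation Φ ℓ e) (φ := fun x => Φ (e.symm x)) (ℓ := QuadGrav.upComp e ℓ)
    (fun x _ a b => rfl)
    (fun x hx => by rw [g.sp_upComp he hx]; exact (hℓ (e.symm x)).2)
    (hRicci e he) (hWeyl e he) hB (hA e he) hx a b
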